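/- **Conventions.** Let $\mathbb R^3_1$ be $\mathbb R^3$ with the metric $\langle a,b\rangle=-a_1b_1+a_2b_2+a_3b_3$ and the Lorentzian cross product $a\boxtimes b=(a_3b_2-a_2b_3,\;a_3b_1-a_1b_3,\;a_1b_2-a_2b_1)$. For $c<0$ let $\mathbb H^2(c)=\{x\in\mathbb R^3_1 : \langle x,x\rangle=1/c,\ x_1>0\}$, and write $\mathbb H^2=\mathbb H^2(-1)$. The Riemannian product $\mathbb H^2\times\mathbb H^2\subset\mathbb R^3_1\times\mathbb R^3_1$ carries the complex structure $J_{(x_1,x_2)}(v_1,v_2)=(x_1\boxtimes v_1,\,-x_2\boxtimes v_2)$ and the Kähler form $\omega=\langle J\cdot,\cdot\rangle$. Its isometries are the maps $(x_1,x_2)\mapsto(A_1x_1,A_2x_2)$ and $(x_1,x_2)\mapsto(A_1x_2,A_2x_1)$ with $A_1,A_2$ in the orthochronous Lorentz group $\mathrm O^+(1,2)$; an isometry is called holomorphic (anti-holomorphic) if it takes $J$ to $J$ (to $-J$). A Lagrangian surface in $\mathbb H^2\times\mathbb H^2$ is a smooth immersion $\Phi:\Sigma\to\mathbb H^2\times\mathbb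 H^2$ of a connected smooth surface $\Sigma$ with $\Phi^*\omega=0$. Its second fundamental form $h$ is parallel if $\nabla^{\perp}_X h(Y,Z)-h(\nabla_XY,Z)-h(Y,\nabla_XZ)=0$ for all (local) tangent vector fields $X,Y,Z$, where $\nabla$ is the Levi-Civita connection of the induced metric and $\nabla^\perp$ the normal connection. **Theorem.** Let $\Phi:\Sigma\to\mathbb H^2\times\mathbb H^2$ be a Lagrangian surface. Then $\Phi$ has parallel second fundamental form if and only if one of the following holds: (a) $\Phi(\Sigma)$ is an open part of a product of curves of constant geodesic curvature: there are open intervals $I_1,I_2\subseteq\mathbb R$ and smooth curves $\beta_1:I_1\to\mathbb H^2$, $\beta_2:I_2\to\mathbb H^2$, parametrized by arc length and of constant geodesic curvature, such that $\Phi(\Sigma)$ is a relatively open subset of $\{(\beta_1(s_1),\beta_2(s_2)) : s_1\in I_1,\ s_2\in I_2\}$; (b) there is a holomorphic or anti-holomorphic isometry $F$ of $\mathbb H^2\times\mathbb H^2$ such that $F(\Phi(\Sigma))$ is an open part (a relatively open subset) of the diagonal surface $\{\tfrac1{\sqrt2}(x,x) : x\in\mathbb H^2(-1/2)\}$. -/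

import Mathlib

open scoped Manifold ContDiff

noncomputable section

namespace HypProd

/-- The vector space underlying three-dimensional Minkowski space `ℝ³₁`. -/
abbrev R31 : Type := Fin 3 → ℝ

/-- The Lorentzian metric of `ℝ³₁`, of signature `(-,+,+)`. -/
def mink (a b : R31) : ℝ := -(a 0 * b 0) + a 1 * b 1 + a 2 * b 2

/-- The Lorentzian cross product of `ℝ³₁`. -/
def lcross (a b : R31) : R31 :=
  ![a 2 * b 1 - a 1 * b 2, a 2 * b 0 - a 0 * b 2, a 0 * b 1 - a 1 * b 0]

/-- The hyperbolic plane of curvature `c < 0`: the upper sheet of a hyperboloid in `ℝ³₁`. -/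
def hyp (c : ℝ) : Set R31 := {x | mink x x = 1 / c ∧ 0 < x 0}

/-- The ambient space `ℝ³₁ × ℝ³₁ = ℝ⁶₂`. -/
abbrev R62 : Type := R31 × R31

/-- The product metric on `ℝ³₁ × ℝ³₁`. -/
def ip (v w : R62) : ℝ := mink v.1 w.1 + mink v.2 w.2

/-- `ℍ² × ℍ²`, the product of two hyperbolic planes of curvature `-1`. -/
def HH : Set R62 := hyp (-1) ×ˢ hyp (-1)

/-- The tangent space of `ℍ² × ℍ²` at `x ∈ ℍ² × ℍ²`, as a subset of `ℝ³₁ × ℝ³₁`. -/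
def tangentHH (x : R62) : Set R62 := {v | mink v.1 x.1 = 0 ∧ mink v.2 x.2 = 0}

/-- The complex structure `J = (J_{ℍ²}, -J_{ℍ²})` at the point `x`, where `J_{ℍ²}` at `y ∈ ℍ²`
is `v ↦ y ⊠ v`. -/
def J (x v : R62) : R62 := (lcross x.1 v.1, -lcross x.2 v.2)

/-- The Kähler form `⟨J ·, ·⟩` at the point `x`. -/
def omega (x v w : R62) : ℝ := ip (J x v) w

/-- Orthogonal projection of `ℝ³₁ × ℝ³₁` onto the tangent space of `ℍ² × ℍ²` at `x`. The
Levi-Civita connection of `ℍ² × ℍ²` is this projection applied to the flat derivative. -/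
def projHH (x w : R62) : R62 :=
  (w.1 + mink w.1 x.1 • x.1, w.2 + mink w.2 x.2 • x.2)

/-! ### Isometries of `ℍ² × ℍ²` -/

/-- The orthochronous Lorentz group `O⁺(1,2)`. -/
def OPlus : Set (Matrix (Fin 3) (Fin 3) ℝ) :=
  {A | (∀ v w : R31, mink (A.mulVec v) (A.mulVec w) = mink v w) ∧ 0 < A 0 0}

/-- `F` belongs to the isometry group of `ℍ² × ℍ²`: it is given by a block diagonal or a block
antidiagonal matrix with blocks in `O⁺(1,2)`. -/
def IsIsometryHH (F : R62 → R62) : Prop :=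
  ∃ A ∈ OPlus, ∃ B ∈ OPlus,
    F = (fun x => (A.mulVec x.1, B.mulVec x.2)) ∨ F = (fun x => (A.mulVec x.2, B.mulVec x.1))

/-- The isometry `F` takes `J` to `J` (`F` is linear, so it is its own differential). -/
def IsHolomorphicHH (F : R62 → R62) : Prop :=
  ∀ x ∈ HH, ∀ v ∈ tangentHH x, F (J x v) = J (F x) (F v)

/-- The isometry `F` takes `J` to `-J`. -/
def IsAntiholomorphicHH (F : R62 → R62) : Prop :=
  ∀ x ∈ HH, ∀ v ∈ tangentHH x, F (J x v) = -J (F x) (F v)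

/-! ### The model surfaces -/

/-- `β`, restricted to the open interval `I`, is a smooth curve in `ℍ²` parametrized by arc
length. -/
structure IsUnitSpeedCurve (I : Set ℝ) (β : ℝ → R31) : Prop where
  isOpen : IsOpen I
  ordConnected : I.OrdConnected
  smooth : ContDiffOn ℝ ∞ β I
  mem : ∀ s ∈ I, β s ∈ hyp (-1)
  unit_speed : ∀ s ∈ I, mink (deriv β s) (deriv β s) = 1

/-- The geodesic curvature of a unit speed curve in `ℍ²` with respect to the unit normal
`β ⊠ β'`. (This normal is tangent to `ℍ²`, so that `⟨β'', β ⊠ β'⟩ = ⟨∇_{β'} β', β ⊠ β'⟩`.) -/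
def geodesicCurvature (β : ℝ → R31) (s : ℝ) : ℝ :=
  mink (deriv (deriv β) s) (lcross (β s) (deriv β s))

/-- The geodesic curvature of `β` is constant on `I`. -/
def HasConstantGeodesicCurvature (I : Set ℝ) (β : ℝ → R31) : Prop :=
  ∃ κ : ℝ, ∀ s ∈ I, geodesicCurvature β s = κ

/-- The image of `I₁ × I₂ → ℍ² × ℍ²`, `(s₁, s₂) ↦ (β₁ s₁, β₂ s₂)`. -/
def productOfCurves (I₁ I₂ : Set ℝ) (β₁ β₂ : ℝ → R31) : Set R62 :=
  {x | ∃ s₁ ∈ I₁, ∃ s₂ ∈ I₂, x = (β₁ s₁, β₂ s₂)}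

/-- The image of the diagonal immersion `ℍ²(-1/2) → ℍ² × ℍ²`, `x ↦ (x, x) / √2`. -/
def diagonalSurface : Set R62 :=
  {y | ∃ x ∈ hyp (-1 / 2), y = (1 / √2) • ((x, x) : R62)}

/-- `A` is an open part of `T`. -/
def IsOpenPart (A T : Set R62) : Prop := ∃ O : Set R62, IsOpen O ∧ A = O ∩ T

/-! ### Submanifold geometry of a parametrized surface `x : U ⊆ ℝ² → ℍ² × ℍ²` -/

/-- The parameter plane. -/
abbrev R2 : Type := EuclideanSpace ℝ (Fin 2)

/-- The coordinate tangent vector `∂ᵢ x` at `u`. -/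
def coordTangent (x : R2 → R62) (u : R2) (i : Fin 2) : R62 :=
  fderiv ℝ x u (EuclideanSpace.single i 1)

/-- The matrix of the induced metric at `u`. -/
def gram (x : R2 → R62) (u : R2) : Matrix (Fin 2) (Fin 2) ℝ :=
  Matrix.of fun i j => ip (coordTangent x u i) (coordTangent x u j)

/-- The vector `a ∈ ℝ²` for which `dx_u(a)` is the orthogonal projection of `w` onto the tangent
plane of the surface: `a = G⁻¹ (⟨w, ∂ⱼ x⟩)ⱼ` where `G` is the Gram matrix. -/
def tangentialPart (x : R2 → R62) (u : R2) (w : R62) : R2 :=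
  WithLp.toLp 2 ((gram x u)⁻¹.mulVec fun j => ip w (coordTangent x u j))

/-- The component of `w` in the normal plane of the surface in `T_{x(u)}(ℍ² × ℍ²)`. -/
def normalPart (x : R2 → R62) (u : R2) (w : R62) : R62 :=
  projHH (x u) w - fderiv ℝ x u (tangentialPart x u (projHH (x u) w))

/-- For vector fields `X`, `Y` on the parameter domain: the covariant derivative, in
`ℍ² × ℍ²`, of the field `dx(Y)` along the surface in the direction `X`. -/
def ambientDeriv (x : R2 → R62) (X Y : R2 → R2) (u : R2) : R62 :=
  projHH (x u) (fderiv ℝ (fun y => fderiv ℝ x y (Y y)) u (X u))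

/-- `∇_X Y` for the Levi-Civita connection `∇` of the induced metric (Gauss formula: the tangential
part of the ambient covariant derivative). -/
def nablaTangent (x : R2 → R62) (X Y : R2 → R2) (u : R2) : R2 :=
  tangentialPart x u (ambientDeriv x X Y u)

/-- The second fundamental form `h(X, Y)`. -/
def sff (x : R2 → R62) (X Y : R2 → R2) (u : R2) : R62 :=
  normalPart x u (ambientDeriv x X Y u)

/-- The normal connection `∇^⊥_X ξ` for a normal field `ξ` along the surface. -/
def nablaNormal (x : R2 → R62) (X : R2 → R2) (ξ : R2 → R62) (u : R2) : R62 :=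
  normalPart x u (fderiv ℝ ξ u (X u))

/-- The van der Waerden–Bortolotti derivative of the second fundamental form:
`(∇̄ h)(X, Y, Z) = ∇^⊥_X h(Y, Z) - h(∇_X Y, Z) - h(Y, ∇_X Z)`. -/
def nablaSff (x : R2 → R62) (X Y Z : R2 → R2) (u : R2) : R62 :=
  nablaNormal x X (sff x Y Z) u
    - sff x (nablaTangent x X Y) Z u - sff x Y (nablaTangent x X Z) u

/-! ### Immersed surfaces -/

section Immersed

variable {S : Type*} [TopologicalSpace S] [ChartedSpace R2 S]

/-- `Φ` is a smooth Lagrangian immersion of the surface `S` into `ℍ² × ℍ²`. -/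
structure IsLagrangianImmersion (Φ : S → R62) : Prop where
  smooth : ContMDiff (𝓡 2) 𝓘(ℝ, R62) ∞ Φ
  mem : ∀ p, Φ p ∈ HH
  immersion : ∀ p, Function.Injective (mfderiv (𝓡 2) 𝓘(ℝ, R62) Φ p)
  lagrangian : ∀ p, ∀ v w : TangentSpace (𝓡 2) p,
    omega (Φ p) (mfderiv (𝓡 2) 𝓘(ℝ, R62) Φ p v) (mfderiv (𝓡 2) 𝓘(ℝ, R62) Φ p w) = 0

/-- `∇̄ h = 0`, tested on all smooth vector fields `X`, `Y`, `Z` on the domain of any smooth chart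
`e` of the surface, the surface being parametrized there by `Φ ∘ e⁻¹`. -/
def HasParallelSff (Φ : S → R62) : Prop :=
  ∀ e ∈ IsManifold.maximalAtlas (𝓡 2) ∞ S, ∀ X Y Z : R2 → R2,
    ContDiffOn ℝ ∞ X e.target → ContDiffOn ℝ ∞ Y e.target → ContDiffOn ℝ ∞ Z e.target →
      ∀ u ∈ e.target, nablaSff (fun y => Φ (e.symm y)) X Y Z u = 0

end Immersed

end HypProd

end

noncomputable section

namespace HypProd

open scoped Topology
open Filter Set

/-! ### Algebra of Minkowski space -/

/-! Parallelism of `h` makes the Codazzi equation purely algebraic: the ambient curvature `R(X,Y)Z`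
has no normal component. On a Lagrangian surface the normal vectors may be taken of the form `JW`.
Write `ω₁`, `ω₂` for the area forms of the two factors pulled back to the surface, and `g₁`, `g₂`
for the pulled back metrics. The Lagrangian condition says `ω₁ = ω₂`, and the identity
`area_identity` in each factor turns Codazzi into `ω₁(X,Y) (g₁(Z,W) - g₂(Z,W)) = 0`. So at each
point either `ω₁ = ω₂ = 0` or `g₁ = g₂` (`IsPatch.dichotomy`). These conditions are closed and
mutually exclusive, so on a connected surface one of them holds everywhere
(`areaZero_or_sameMetric`).

If the area forms vanish, each component has rank one and carries a unit normal `n` and a curvature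
`κ` with `dn = -κ dy` (`exists_curveFrame`). In such frames `∇̄h` consists of the terms `dκᵢ(X)
gᵢ(Y,Z) nᵢ` (`IsPatch.nablaSff_of_frames`), so parallel means that the `κᵢ` are locally constant.
Then `a = n + κ y` is locally constant too, and the component lies in the plane section `⟨y,a⟩ =
-κ`, where `⟨a,a⟩ = 1 - κ²`. The pair `(a,κ)` is unique up to a common sign (`InCurve.unique`),
hence global. A connected subset of a plane section lies in one orbit of the group `exp(s a ⊠ ·)`
(`exists_orbit`), which is a unit speed curve of constant curvature.

If the metrics agree, the linear map taking `x₁` to `x₂` and `dx₁` to `dx₂` is a Lorentz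
transformation at each point. Its derivative vanishes by the algebra that proves uniqueness of the
Levi-Civita connection (`IsPatch.exists_intertwines`). Hence `Φ₂ = M Φ₁` with `M` constant; `ω₁ =
ω₂` forces `det M = 1`, and `(M, 1)` is a holomorphic isometry carrying the surface into the
diagonal.

Conversely, constant curvature curves lie in plane sections, where the formula for `∇̄h` gives zero.
A surface satisfying `A Φ₁ = B Φ₂` with Lorentz transformations `A`, `B` is totally geodesic
(`IsPatch.sff_eq_zero_of_graph`).

In both directions openness in the model comes from two linear functionals that are local
coordinates on the surface and on the model. -/

theorem mink_comm (a b : R31) : mink a b = mink b a := by simp only [mink]; ring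

theorem mink_add_left (a b c : R31) : mink (a + b) c = mink a c + mink b c := by
  simp only [mink, Pi.add_apply]; ring

theorem mink_add_right (a b c : R31) : mink a (b + c) = mink a b + mink a c := by
  simp only [mink, Pi.add_apply]; ring

theorem mink_smul_left (r : ℝ) (a b : R31) : mink (r • a) b = r * mink a b := by
  simp only [mink, Pi.smul_apply, smul_eq_mul]; ring

theorem mink_smul_right (r : ℝ) (a b : R31) : mink a (r • b) = r * mink a b := by
  simp only [mink, Pi.smul_apply, smul_eq_mul]; ring

theorem mink_sub_left (a b c : R31) : mink (a - b) c = mink a c - mink b c := by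
  simp only [mink, Pi.sub_apply]; ring

theorem mink_sub_right (a b c : R31) : mink a (b - c) = mink a b - mink a c := by
  simp only [mink, Pi.sub_apply]; ring

theorem mink_neg_left (a b : R31) : mink (-a) b = -mink a b := by
  simp only [mink, Pi.neg_apply]; ring

theorem mink_neg_right (a b : R31) : mink a (-b) = -mink a b := by
  simp only [mink, Pi.neg_apply]; ring

@[simp] theorem mink_zero_left (a : R31) : mink 0 a = 0 := by simp [mink]

@[simp] theorem mink_zero_right (a : R31) : mink a 0 = 0 := by simp [mink]

/-- The Lorentzian metric as a continuous bilinear map. -/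
def minkL : R31 →L[ℝ] R31 →L[ℝ] ℝ :=
  LinearMap.toContinuousLinearMap
    ((LinearMap.toContinuousLinearMap : (R31 →ₗ[ℝ] ℝ) ≃ₗ[ℝ] (R31 →L[ℝ] ℝ)).toLinearMap ∘ₗ
      LinearMap.mk₂ ℝ mink mink_add_left mink_smul_left mink_add_right mink_smul_right)

@[simp] theorem minkL_apply (a b : R31) : minkL a b = mink a b := rfl

/-- Left multiplication by `a` for the Lorentzian cross product. -/
def lcrossL : R31 →L[ℝ] R31 →L[ℝ] R31 :=
  LinearMap.toContinuousLinearMap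
    ((LinearMap.toContinuousLinearMap : (R31 →ₗ[ℝ] R31) ≃ₗ[ℝ] (R31 →L[ℝ] R31)).toLinearMap ∘ₗ
      LinearMap.mk₂ ℝ lcross
        (fun a b c => by ext i; fin_cases i <;> simp [lcross] <;> ring)
        (fun a b c => by ext i; fin_cases i <;> simp [lcross] <;> ring)
        (fun a b c => by ext i; fin_cases i <;> simp [lcross] <;> ring)
        (fun a b c => by ext i; fin_cases i <;> simp [lcross] <;> ring))

@[simp] theorem lcrossL_apply (a b : R31) : lcrossL a b = lcross a b := rfl

theorem mink_lcross (a b c : R31) : mink (lcross a b) c =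
    a 0 * (b 1 * c 2 - b 2 * c 1) - a 1 * (b 0 * c 2 - b 2 * c 0)
      + a 2 * (b 0 * c 1 - b 1 * c 0) := by
  simp [mink, lcross]; ring

theorem mink_lcross_self_left (a b : R31) : mink (lcross a b) a = 0 := by
  rw [mink_lcross]; ring

theorem mink_lcross_self_right (a b : R31) : mink (lcross a b) b = 0 := by
  rw [mink_lcross]; ring

theorem mink_lcross_lcross (a b c d : R31) : mink (lcross a b) (lcross c d) =
    mink a d * mink b c - mink a c * mink b d := by
  simp [mink, lcross]; ring

theorem mink_lcross_swap (a b c : R31) : mink (lcross a b) c = -mink (lcross a c) b := by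
  simp only [mink_lcross]; ring

theorem mink_lcross_rotate (a b c : R31) : mink (lcross a b) c = mink (lcross b c) a := by
  simp only [mink_lcross]; ring

theorem lcross_lcross (a b c : R31) :
    lcross a (lcross b c) = mink b a • c - mink c a • b := by
  ext i; fin_cases i <;> simp [lcross, mink] <;> ring

/-- A vector orthogonal to three vectors with nonzero determinant vanishes. -/
theorem eq_zero_of_mink_eq_zero {a b c w : R31} (h : mink (lcross a b) c ≠ 0)
    (ha : mink w a = 0) (hb : mink w b = 0) (hc : mink w c = 0) : w = 0 := by
  -- Cramer's rule: the coefficients are cofactors of the matrix with rows `a`, `b`, `c`, with signs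
  -- adapted to the metric.
  have key : ∀ i, mink (lcross a b) c * w i = 0 := by
    rw [mink_lcross]
    simp only [mink] at ha hb hc
    intro i
    fin_cases i
    · simp only [Fin.mk_zero, Fin.isValue]
      linear_combination (b 2 * c 1 - b 1 * c 2) * ha + (c 2 * a 1 - c 1 * a 2) * hb
        + (a 2 * b 1 - a 1 * b 2) * hc
    · simp only [Fin.mk_one, Fin.isValue]
      linear_combination (b 2 * c 0 - b 0 * c 2) * ha + (c 2 * a 0 - c 0 * a 2) * hb
        + (a 2 * b 0 - a 0 * b 2) * hc
    · simp only [Fin.reduceFinMk, Fin.isValue]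
      linear_combination (b 0 * c 1 - b 1 * c 0) * ha + (c 0 * a 1 - c 1 * a 0) * hb
        + (a 0 * b 1 - a 1 * b 0) * hc
  ext i
  simpa [h] using key i

theorem eq_of_mink_eq {v w : R31} (h : ∀ c, mink v c = mink w c) : v = w := by
  have key : ∀ c, mink (v - w) c = 0 := fun c => by rw [mink_sub_left, h c, sub_self]
  refine sub_eq_zero.1 (eq_zero_of_mink_eq_zero (a := ![1, 0, 0]) (b := ![0, 1, 0])
    (c := ![0, 0, 1]) ?_ (key _) (key _) (key _))
  simp [mink_lcross]

theorem mem_hyp_iff {x : R31} : x ∈ hyp (-1) ↔ mink x x = -1 ∧ 0 < x 0 := by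
  simp [hyp]

theorem mink_self_of_mem {x : R31} (hx : x ∈ hyp (-1)) : mink x x = -1 := (mem_hyp_iff.1 hx).1

/-- The Lorentzian metric is positive definite on the tangent planes of `ℍ²`. -/
theorem mink_self_pos {x v : R31} (hx : x ∈ hyp (-1)) (hv : mink v x = 0) (h0 : v ≠ 0) :
    0 < mink v v := by
  obtain ⟨hx1, hx0⟩ := mem_hyp_iff.1 hx
  simp only [mink] at *
  -- Eliminate `v 0` by `x 0 * v 0 = x 1 * v 1 + x 2 * v 2` and use `x 0 ^ 2 = 1 + x 1 ^ 2 + x 2 ^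
  -- 2`; Lagrange's identity then gives a sum of squares.
  have h1 : x 0 ^ 2 * (-(v 0 * v 0) + v 1 * v 1 + v 2 * v 2) =
      v 1 ^ 2 + v 2 ^ 2 + (v 1 * x 2 - v 2 * x 1) ^ 2 := by
    linear_combination (-v 0 * x 0 - v 1 * x 1 - v 2 * x 2) * (-hv)
      - (v 1 ^ 2 + v 2 ^ 2) * hx1
  have h2 : 0 < v 1 ^ 2 + v 2 ^ 2 := by
    by_contra hcon
    have e1 : v 1 = 0 := by nlinarith [sq_nonneg (v 1), sq_nonneg (v 2)]
    have e2 : v 2 = 0 := by nlinarith [sq_nonneg (v 1), sq_nonneg (v 2)]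
    have e0 : v 0 = 0 := by
      simpa [e1, e2, hx0.ne'] using hv
    exact h0 (by ext i; fin_cases i <;> simp [e0, e1, e2])
  have h3 : 0 < x 0 ^ 2 * (-(v 0 * v 0) + v 1 * v 1 + v 2 * v 2) := by
    rw [h1]; positivity
  exact pos_of_mul_pos_right h3 (by positivity)

theorem eq_zero_of_mink_self {x v : R31} (hx : x ∈ hyp (-1)) (hv : mink v x = 0)
    (h : mink v v = 0) : v = 0 := by
  by_contra h0
  exact (mink_self_pos hx hv h0).ne' h

theorem mink_self_nonneg {x v : R31} (hx : x ∈ hyp (-1)) (hv : mink v x = 0) :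
    0 ≤ mink v v := by
  by_cases h0 : v = 0
  · simp [h0]
  · exact (mink_self_pos hx hv h0).le

theorem mink_lcross_self_of_mem {x v : R31} (hx : x ∈ hyp (-1)) (hv : mink v x = 0) :
    mink (lcross x v) (lcross x v) = mink v v := by
  rw [mink_lcross_lcross, mink_self_of_mem hx, hv]; ring

/-- Tangent vectors of `ℍ²` on which the area form vanishes are parallel. -/
theorem parallel_of_area_eq_zero {x v w : R31} (hx : x ∈ hyp (-1)) (hv : mink v x = 0)
    (hw : mink w x = 0) (h0 : v ≠ 0) (h : mink (lcross x v) w = 0) :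
    w = (mink w v / mink v v) • v := by
  have hp := mink_self_pos hx hv h0
  refine sub_eq_zero.1 (eq_zero_of_mink_eq_zero (a := x) (b := v) (c := lcross x v) ?_ ?_ ?_ ?_)
  · rw [mink_lcross_self_of_mem hx hv]; exact hp.ne'
  · rw [mink_sub_left, mink_smul_left, hv, hw]; ring
  · rw [mink_sub_left, mink_smul_left]; field_simp; ring
  · rw [mink_sub_left, mink_smul_left, mink_comm w, h, mink_comm v (lcross x v),
      mink_lcross_self_right]; ring

/-- Expansion in the orthonormal frame `x`, `n ⊠ x`, `n`. -/
theorem frame_expansion {x n : R31} (hx : x ∈ hyp (-1)) (hn : mink n n = 1) (hnx : mink n x = 0)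
    (w : R31) :
    w = -mink w x • x + mink w (lcross n x) • lcross n x + mink w n • n := by
  have hxx := mink_self_of_mem hx
  have h1 : mink (lcross n x) x = 0 := mink_lcross_self_right _ _
  have h2 : mink (lcross n x) n = 0 := mink_lcross_self_left _ _
  have h3 : mink (lcross n x) (lcross n x) = 1 := by
    rw [mink_lcross_lcross, hxx, hn, hnx, mink_comm x, hnx]; ring
  have h1' := h1; rw [mink_comm] at h1'
  have h2' := h2; rw [mink_comm] at h2'
  have h4 := hnx; rw [mink_comm] at h4
  refine sub_eq_zero.1 (eq_zero_of_mink_eq_zero (a := n) (b := x) (c := lcross n x) ?_ ?_ ?_ ?_)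
  · rw [h3]; exact one_ne_zero
  all_goals
    simp only [mink_sub_left, mink_add_left, mink_smul_left, h1, h2, h3, h1', h2', h4, hn, hnx, hxx]
    ring

/-- In an oriented plane, `⟨X, Z⟩ Y - ⟨Y, Z⟩ X` is the area of `X, Y` times the rotated `Z`. -/
theorem area_identity {x X Y Z W : R31} (hZ : mink Z x = 0) :
    mink X Z * mink (lcross x W) Y - mink Y Z * mink (lcross x W) X =
      mink (lcross x X) Y * mink Z W := by
  -- Evaluate `⟨x ⊠ W, Z ⊠ (X ⊠ Y)⟩` both by the Gram formula and by expanding the double cross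
  -- product.
  have h1 := mink_lcross_lcross x W Z (lcross X Y)
  rw [lcross_lcross, mink_sub_right, mink_smul_right, mink_smul_right, mink_comm x Z, hZ] at h1
  rw [mink_lcross_rotate x X Y, mink_comm (lcross X Y) x, mink_comm Z W]
  linear_combination h1

/-! ### Differentiating the metric -/

theorem differentiableAt_mink {f g : R2 → R31} {u : R2} (hf : DifferentiableAt ℝ f u)
    (hg : DifferentiableAt ℝ g u) : DifferentiableAt ℝ (fun y => mink (f y) (g y)) u :=
  (minkL.hasFDerivAt_of_bilinear hf.hasFDerivAt hg.hasFDerivAt).differentiableAt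

theorem fderiv_mink {f g : R2 → R31} {u : R2} (hf : DifferentiableAt ℝ f u)
    (hg : DifferentiableAt ℝ g u) (v : R2) : fderiv ℝ (fun y => mink (f y) (g y)) u v =
      mink (fderiv ℝ f u v) (g u) + mink (f u) (fderiv ℝ g u v) := by
  have h := (minkL.hasFDerivAt_of_bilinear hf.hasFDerivAt hg.hasFDerivAt).fderiv
  simp only [minkL_apply] at h
  rw [h]
  simp [add_comm]

theorem contDiffAt_mink {f g : R2 → R31} {u : R2} {n : WithTop ℕ∞} (hf : ContDiffAt ℝ n f u)
    (hg : ContDiffAt ℝ n g u) : ContDiffAt ℝ n (fun y => mink (f y) (g y)) u :=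
  (minkL.isBoundedBilinearMap.contDiff.contDiffAt).comp u (hf.prodMk hg)

theorem contDiffAt_lcross {f g : R2 → R31} {u : R2} {n : WithTop ℕ∞} (hf : ContDiffAt ℝ n f u)
    (hg : ContDiffAt ℝ n g u) : ContDiffAt ℝ n (fun y => lcross (f y) (g y)) u :=
  (lcrossL.isBoundedBilinearMap.contDiff.contDiffAt).comp u (hf.prodMk hg)

/-- Differentiating a locally constant value of the metric. -/
theorem mink_fderiv_of_eventually_eq {f g : R2 → R31} {u : R2} {c : ℝ}
    (hf : DifferentiableAt ℝ f u) (hg : DifferentiableAt ℝ g u)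
    (h : ∀ᶠ y in 𝓝 u, mink (f y) (g y) = c) (v : R2) :
    mink (fderiv ℝ f u v) (g u) = -mink (f u) (fderiv ℝ g u v) := by
  have h1 := fderiv_mink hf hg v
  have h2 : fderiv ℝ (fun y => mink (f y) (g y)) u = 0 := by
    rw [Filter.EventuallyEq.fderiv_eq (f := fun _ => c) h]; simp
  rw [h2] at h1
  simp only [zero_apply] at h1
  linarith

theorem mink_fderiv_self_of_eventually_eq {f : R2 → R31} {u : R2} {c : ℝ}
    (hf : DifferentiableAt ℝ f u) (h : ∀ᶠ y in 𝓝 u, mink (f y) (f y) = c) (v : R2) :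
    mink (fderiv ℝ f u v) (f u) = 0 := by
  have h1 := mink_fderiv_of_eventually_eq hf hf h v
  rw [mink_comm (f u)] at h1
  linarith

theorem fderiv_fst_apply {f : R2 → R62} {u : R2} (h : DifferentiableAt ℝ f u) (v : R2) :
    fderiv ℝ (fun y => (f y).1) u v = (fderiv ℝ f u v).1 := by
  rw [fderiv.fst h]; rfl

theorem fderiv_snd_apply {f : R2 → R62} {u : R2} (h : DifferentiableAt ℝ f u) (v : R2) :
    fderiv ℝ (fun y => (f y).2) u v = (fderiv ℝ f u v).2 := by
  rw [fderiv.snd h]; rfl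

/-! ### The product metric -/

theorem ip_comm (a b : R62) : ip a b = ip b a := by simp only [ip, mink_comm]

theorem ip_add_left (a b c : R62) : ip (a + b) c = ip a c + ip b c := by
  simp only [ip, Prod.fst_add, Prod.snd_add, mink_add_left]; ring

theorem ip_sub_left (a b c : R62) : ip (a - b) c = ip a c - ip b c := by
  simp only [ip, Prod.fst_sub, Prod.snd_sub, mink_sub_left]; ring

theorem ip_smul_left (r : ℝ) (a b : R62) : ip (r • a) b = r * ip a b := by
  simp only [ip, Prod.smul_fst, Prod.smul_snd, mink_smul_left]; ring

theorem ip_add_right (a b c : R62) : ip a (b + c) = ip a b + ip a c := by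
  rw [ip_comm, ip_add_left, ip_comm b, ip_comm c]

theorem ip_smul_right (r : ℝ) (a b : R62) : ip a (r • b) = r * ip a b := by
  rw [ip_comm, ip_smul_left, ip_comm]

@[simp] theorem ip_zero_left (a : R62) : ip 0 a = 0 := by simp [ip]

theorem ip_self_nonneg {x v : R62} (hx : x ∈ HH) (hv : v ∈ tangentHH x) : 0 ≤ ip v v :=
  add_nonneg (mink_self_nonneg hx.1 hv.1) (mink_self_nonneg hx.2 hv.2)

theorem eq_zero_of_ip_self {x v : R62} (hx : x ∈ HH) (hv : v ∈ tangentHH x) (h : ip v v = 0) :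
    v = 0 := by
  have h1 := mink_self_nonneg hx.1 hv.1
  have h2 := mink_self_nonneg hx.2 hv.2
  simp only [ip] at h
  exact Prod.ext (eq_zero_of_mink_self hx.1 hv.1 (by linarith))
    (eq_zero_of_mink_self hx.2 hv.2 (by linarith))

theorem projHH_mem {x : R62} (hx : x ∈ HH) (w : R62) : projHH x w ∈ tangentHH x := by
  constructor <;> simp [projHH, mink_add_left, mink_smul_left, mink_self_of_mem hx.1,
    mink_self_of_mem hx.2]

theorem projHH_of_mem {x w : R62} (hw : w ∈ tangentHH x) : projHH x w = w := by
  simp [projHH, hw.1, hw.2]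

theorem ip_projHH {x N : R62} (hN : N ∈ tangentHH x) (w : R62) : ip (projHH x w) N = ip w N := by
  simp [projHH, ip, mink_add_left, mink_smul_left, mink_comm x.1, mink_comm x.2, hN.1, hN.2]

theorem tangentHH_sub {x v w : R62} (hv : v ∈ tangentHH x) (hw : w ∈ tangentHH x) :
    v - w ∈ tangentHH x := by
  constructor
  · rw [Prod.fst_sub, mink_sub_left, hv.1, hw.1, sub_zero]
  · rw [Prod.snd_sub, mink_sub_left, hv.2, hw.2, sub_zero]

/-! ### Parametrized surfaces in `ℍ² × ℍ²` -/

/-- `x` is a smooth immersion of the open subset `U` of the plane into `ℍ² × ℍ²`. -/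
structure IsPatch (x : R2 → R62) (U : Set R2) : Prop where
  isOpen : IsOpen U
  smooth : ∀ u ∈ U, ContDiffAt ℝ ∞ x u
  mem : ∀ u ∈ U, x u ∈ HH
  inj : ∀ u ∈ U, Function.Injective (fderiv ℝ x u)

theorem infty_add_one_le : (∞ : WithTop ℕ∞) + 1 ≤ ∞ := le_rfl

theorem differentiableAt_of_infty {E F : Type*} [NormedAddCommGroup E]
    [NormedSpace ℝ E] [NormedAddCommGroup F] [NormedSpace ℝ F] {f : E → F} {u : E}
    (h : ContDiffAt ℝ ∞ f u) : DifferentiableAt ℝ f u :=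
  h.differentiableAt (by simp)

theorem contDiffAt_fderiv {E F : Type*} [NormedAddCommGroup E]
    [NormedSpace ℝ E] [NormedAddCommGroup F] [NormedSpace ℝ F] {f : E → F} {u : E}
    (h : ContDiffAt ℝ ∞ f u) : ContDiffAt ℝ ∞ (fderiv ℝ f) u :=
  h.fderiv_right infty_add_one_le

theorem contDiffAt_fderiv_apply {E F : Type*} [NormedAddCommGroup E]
    [NormedSpace ℝ E] [NormedAddCommGroup F] [NormedSpace ℝ F] {f : E → F} {Y : E → E} {u : E}
    (h : ContDiffAt ℝ ∞ f u) (hY : ContDiffAt ℝ ∞ Y u) :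
    ContDiffAt ℝ ∞ (fun y => fderiv ℝ f y (Y y)) u :=
  (contDiffAt_fderiv h).clm_apply hY

theorem fderiv_fderiv_apply {E F : Type*} [NormedAddCommGroup E]
    [NormedSpace ℝ E] [NormedAddCommGroup F] [NormedSpace ℝ F] {f : E → F} {Y : E → E} {u : E}
    (h : ContDiffAt ℝ ∞ f u) (hY : DifferentiableAt ℝ Y u) (v : E) :
    fderiv ℝ (fun y => fderiv ℝ f y (Y y)) u v =
      fderiv ℝ (fderiv ℝ f) u v (Y u) + fderiv ℝ f u (fderiv ℝ Y u v) := by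
  rw [fderiv_clm_apply (differentiableAt_of_infty (contDiffAt_fderiv h)) hY]
  simp [add_comm]

theorem fderiv_fderiv_symm {E F : Type*} [NormedAddCommGroup E]
    [NormedSpace ℝ E] [NormedAddCommGroup F] [NormedSpace ℝ F] {f : E → F} {u : E}
    (h : ContDiffAt ℝ ∞ f u) (v w : E) :
    fderiv ℝ (fderiv ℝ f) u v w = fderiv ℝ (fderiv ℝ f) u w v :=
  (h.isSymmSndFDerivAt (by
    rw [minSmoothness_of_isRCLikeNormedField]
    exact WithTop.coe_le_coe.2 (le_top : (2 : ℕ∞) ≤ ⊤))) v w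

theorem fderiv_eq_sum_coordTangent (x : R2 → R62) (u a : R2) :
    fderiv ℝ x u a = ∑ i, a i • coordTangent x u i := by
  have h : a = ∑ i, a i • EuclideanSpace.single i (1 : ℝ) := by
    ext i; fin_cases i <;> simp
  conv_lhs => rw [h]
  rw [map_sum]
  simp only [map_smul, coordTangent]

/-- The inverse Gram matrix is the adjugate over the determinant. Smoothness matters because `∇_X Z`
is itself inserted into `h` as a vector field and is differentiated there. -/
theorem contDiffAt_tangentialPart {x w : R2 → R62} {u : R2} (hx : ContDiffAt ℝ ∞ x u)
    (hw : ContDiffAt ℝ ∞ w u) (hdet : (gram x u).det ≠ 0) :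
    ContDiffAt ℝ ∞ (fun y => tangentialPart x y (w y)) u := by
  have hip : ∀ f g : R2 → R62, ContDiffAt ℝ ∞ f u → ContDiffAt ℝ ∞ g u →
      ContDiffAt ℝ ∞ (fun y => ip (f y) (g y)) u := fun f g hf hg =>
    (contDiffAt_mink hf.fst hg.fst).add (contDiffAt_mink hf.snd hg.snd)
  have hT : ∀ i, ContDiffAt ℝ ∞ (fun y => coordTangent x y i) u := fun i =>
    contDiffAt_fderiv_apply hx contDiffAt_const
  have hG : ∀ i j, ContDiffAt ℝ ∞ (fun y => gram x y i j) u := fun i j =>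
    hip _ _ (hT i) (hT j)
  have hd : ContDiffAt ℝ ∞ (fun y => (gram x y).det) u := by
    simp only [Matrix.det_fin_two]
    exact ((hG 0 0).mul (hG 1 1)).sub ((hG 0 1).mul (hG 1 0))
  have hinv : ∀ i j, ContDiffAt ℝ ∞ (fun y => (gram x y)⁻¹ i j) u := by
    intro i j
    simp only [Matrix.inv_def, Matrix.adjugate_fin_two, Ring.inverse_eq_inv', Matrix.smul_apply,
      smul_eq_mul]
    refine (hd.inv hdet).mul ?_
    fin_cases i <;> fin_cases j
    · exact hG 1 1
    · exact (hG 0 1).neg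
    · exact (hG 1 0).neg
    · exact hG 0 0
  rw [contDiffAt_piLp]
  intro i
  simp only [tangentialPart, Matrix.mulVec, dotProduct]
  exact ContDiffAt.sum fun j _ => (hinv i j).mul (hip _ _ hw (hT j))

namespace IsPatch

variable {x : R2 → R62} {U : Set R2} {u : R2}

theorem eventually (h : IsPatch x U) (hu : u ∈ U) : ∀ᶠ y in 𝓝 u, y ∈ U :=
  h.isOpen.mem_nhds hu

theorem diff (h : IsPatch x U) (hu : u ∈ U) : DifferentiableAt ℝ x u :=
  differentiableAt_of_infty (h.smooth u hu)

theorem fderiv_mem (h : IsPatch x U) (hu : u ∈ U) (v : R2) :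
    fderiv ℝ x u v ∈ tangentHH (x u) := by
  constructor
  · rw [← fderiv_fst_apply (h.diff hu)]
    exact mink_fderiv_self_of_eventually_eq (h.diff hu).fst
      ((h.eventually hu).mono fun y hy => mink_self_of_mem (h.mem y hy).1) v
  · rw [← fderiv_snd_apply (h.diff hu)]
    exact mink_fderiv_self_of_eventually_eq (h.diff hu).snd
      ((h.eventually hu).mono fun y hy => mink_self_of_mem (h.mem y hy).2) v

theorem ip_fderiv_self_pos (h : IsPatch x U) (hu : u ∈ U) {v : R2} (hv : v ≠ 0) :
    0 < ip (fderiv ℝ x u v) (fderiv ℝ x u v) := by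
  refine lt_of_le_of_ne (ip_self_nonneg (h.mem u hu) (h.fderiv_mem hu v)) fun h0 => hv ?_
  exact h.inj u hu ((eq_zero_of_ip_self (h.mem u hu) (h.fderiv_mem hu v) h0.symm).trans
    (map_zero _).symm)

theorem gram_mulVec (x : R2 → R62) (u a : R2) (i : Fin 2) :
    (gram x u).mulVec a i = ip (fderiv ℝ x u a) (coordTangent x u i) := by
  rw [fderiv_eq_sum_coordTangent]
  simp [Matrix.mulVec, dotProduct, gram, ip_add_left, ip_smul_left, Fin.sum_univ_two,
    ip_comm (coordTangent x u i)]
  ring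

/-- A kernel vector of the Gram matrix would give a tangent vector orthogonal to the whole tangent
plane, hence to itself, although the induced metric is positive definite. -/
theorem gram_det_ne_zero (h : IsPatch x U) (hu : u ∈ U) : (gram x u).det ≠ 0 := by
  intro h0
  obtain ⟨a, ha, ha0⟩ := Matrix.exists_mulVec_eq_zero_iff.2 h0
  have h1 : WithLp.toLp 2 a ≠ 0 := fun h2 => ha (by
    ext i; exact congrArg (fun z : R2 => z i) h2)
  refine (h.ip_fderiv_self_pos hu h1).ne' ?_
  have h3 : ∀ i, ip (fderiv ℝ x u (WithLp.toLp 2 a)) (coordTangent x u i) = 0 := fun i => by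
    rw [← gram_mulVec]; exact congrFun ha0 i
  rw [congrArg (ip (fderiv ℝ x u (WithLp.toLp 2 a))) (fderiv_eq_sum_coordTangent x u _)]
  simp only [Fin.sum_univ_two, ip_add_right, ip_smul_right, h3]
  ring

/-- The defining property of the tangential part. -/
theorem ip_tangentialPart (h : IsPatch x U) (hu : u ∈ U) (w : R62) (v : R2) :
    ip (fderiv ℝ x u (tangentialPart x u w)) (fderiv ℝ x u v) = ip w (fderiv ℝ x u v) := by
  have h1 : ∀ i, ip (fderiv ℝ x u (tangentialPart x u w)) (coordTangent x u i) =
      ip w (coordTangent x u i) := by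
    intro i
    rw [← gram_mulVec]
    simp only [tangentialPart]
    rw [Matrix.mulVec_mulVec, Matrix.mul_nonsing_inv _ (isUnit_iff_ne_zero.2
      (h.gram_det_ne_zero hu)), Matrix.one_mulVec]
  conv_lhs => rw [fderiv_eq_sum_coordTangent x u v]
  conv_rhs => rw [fderiv_eq_sum_coordTangent x u v]
  simp only [Fin.sum_univ_two, ip_add_right, ip_smul_right, h1]

theorem normalPart_mem (h : IsPatch x U) (hu : u ∈ U) (w : R62) :
    normalPart x u w ∈ tangentHH (x u) :=
  tangentHH_sub (projHH_mem (h.mem u hu) w) (h.fderiv_mem hu _)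

theorem ip_normalPart_fderiv (h : IsPatch x U) (hu : u ∈ U) (w : R62) (v : R2) :
    ip (normalPart x u w) (fderiv ℝ x u v) = 0 := by
  rw [normalPart, ip_sub_left, h.ip_tangentialPart hu, sub_self]

theorem ip_normalPart {N : R62} (hN : N ∈ tangentHH (x u))
    (hN' : ∀ v, ip N (fderiv ℝ x u v) = 0) (w : R62) : ip (normalPart x u w) N = ip w N := by
  rw [normalPart, ip_sub_left, ip_projHH hN, ip_comm (fderiv ℝ x u _), hN', sub_zero]

theorem contDiffAt_projHH {w : R2 → R62} (hx : ContDiffAt ℝ ∞ x u) (hw : ContDiffAt ℝ ∞ w u) :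
    ContDiffAt ℝ ∞ (fun y => projHH (x y) (w y)) u :=
  ContDiffAt.prodMk (hw.fst.add ((contDiffAt_mink hw.fst hx.fst).smul hx.fst))
    (hw.snd.add ((contDiffAt_mink hw.snd hx.snd).smul hx.snd))

theorem contDiffAt_ambientDeriv (h : IsPatch x U) (hu : u ∈ U) {X Y : R2 → R2}
    (hX : ContDiffAt ℝ ∞ X u) (hY : ContDiffAt ℝ ∞ Y u) :
    ContDiffAt ℝ ∞ (ambientDeriv x X Y) u :=
  contDiffAt_projHH (h.smooth u hu)
    (contDiffAt_fderiv_apply (contDiffAt_fderiv_apply (h.smooth u hu) hY) hX)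

theorem contDiffAt_nablaTangent (h : IsPatch x U) (hu : u ∈ U) {X Y : R2 → R2}
    (hX : ContDiffAt ℝ ∞ X u) (hY : ContDiffAt ℝ ∞ Y u) :
    ContDiffAt ℝ ∞ (nablaTangent x X Y) u :=
  contDiffAt_tangentialPart (h.smooth u hu) (h.contDiffAt_ambientDeriv hu hX hY)
    (h.gram_det_ne_zero hu)

end IsPatch

namespace IsPatch

variable {x : R2 → R62} {U : Set R2} {u : R2}

/-! ### The Codazzi equation -/

theorem sff_eq (h : IsPatch x U) (hu : u ∈ U) (Y Z : R2 → R2) :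
    sff x Y Z u = projHH (x u) (fderiv ℝ (fun y => fderiv ℝ x y (Z y)) u (Y u)) -
      fderiv ℝ x u (nablaTangent x Y Z u) := by
  simp only [sff, normalPart, nablaTangent, ambientDeriv,
    projHH_of_mem (projHH_mem (h.mem u hu) _)]

/-- Differentiate `⟨dx(Z), x⟩ = 0`. The radial part of the second derivative thus involves first
derivatives only; it is the source of the curvature terms in the Codazzi equation. -/
theorem mink_fst_second (h : IsPatch x U) (hu : u ∈ U) {Z : R2 → R2}
    (hZ : DifferentiableAt ℝ Z u) (v : R2) :
    mink (fderiv ℝ (fun y => fderiv ℝ x y (Z y)) u v).1 (x u).1 =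
      -mink (fderiv ℝ x u v).1 (fderiv ℝ x u (Z u)).1 := by
  have hd : DifferentiableAt ℝ (fun y => fderiv ℝ x y (Z y)) u :=
    (differentiableAt_of_infty (contDiffAt_fderiv (h.smooth u hu))).clm_apply hZ
  rw [← fderiv_fst_apply hd, mink_fderiv_of_eventually_eq hd.fst (h.diff hu).fst
    ((h.eventually hu).mono fun y hy => (h.fderiv_mem hy (Z y)).1), fderiv_fst_apply (h.diff hu),
    mink_comm]

theorem mink_snd_second (h : IsPatch x U) (hu : u ∈ U) {Z : R2 → R2}
    (hZ : DifferentiableAt ℝ Z u) (v : R2) :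
    mink (fderiv ℝ (fun y => fderiv ℝ x y (Z y)) u v).2 (x u).2 =
      -mink (fderiv ℝ x u v).2 (fderiv ℝ x u (Z u)).2 := by
  have hd : DifferentiableAt ℝ (fun y => fderiv ℝ x y (Z y)) u :=
    (differentiableAt_of_infty (contDiffAt_fderiv (h.smooth u hu))).clm_apply hZ
  rw [← fderiv_snd_apply hd, mink_fderiv_of_eventually_eq hd.snd (h.diff hu).snd
    ((h.eventually hu).mono fun y hy => (h.fderiv_mem hy (Z y)).2), fderiv_snd_apply (h.diff hu),
    mink_comm]

theorem mink_fderiv_add_smul {w y : R2 → R31} (hw : DifferentiableAt ℝ w u)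
    (hy : DifferentiableAt ℝ y u) {N : R31} (hN : mink N (y u) = 0) (v : R2) :
    mink (fderiv ℝ (fun z => w z + mink (w z) (y z) • y z) u v) N =
      mink (fderiv ℝ w u v) N + mink (w u) (y u) * mink (fderiv ℝ y u v) N := by
  have hm := differentiableAt_mink hw hy
  rw [fderiv_fun_add hw (hm.fun_smul hy), fderiv_fun_smul hm hy]
  simp [mink_add_left, mink_smul_left, mink_comm (y u) N, hN]

/-- Since `N` is orthogonal to both components of `x`, the derivative of the correction `⟨w,x⟩ x`
contributes only through the differentiated last factor. -/
theorem ip_fderiv_projHH {w : R2 → R62} (hx : DifferentiableAt ℝ x u)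
    (hw : DifferentiableAt ℝ w u) {N : R62} (hN : N ∈ tangentHH (x u)) (v : R2) :
    ip (fderiv ℝ (fun z => projHH (x z) (w z)) u v) N = ip (fderiv ℝ w u v) N +
      mink (w u).1 (x u).1 * mink (fderiv ℝ x u v).1 N.1 +
      mink (w u).2 (x u).2 * mink (fderiv ℝ x u v).2 N.2 := by
  have h1 : DifferentiableAt ℝ (fun z => projHH (x z) (w z)) u :=
    DifferentiableAt.prodMk
      (hw.fst.add ((differentiableAt_mink hw.fst hx.fst).smul hx.fst))
      (hw.snd.add ((differentiableAt_mink hw.snd hx.snd).smul hx.snd))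
  have h2 := mink_fderiv_add_smul hw.fst hx.fst hN.1 v
  have h3 := mink_fderiv_add_smul hw.snd hx.snd hN.2 v
  simp only [ip]
  rw [← fderiv_fst_apply h1, ← fderiv_snd_apply h1, ← fderiv_fst_apply hx, ← fderiv_snd_apply hx,
    ← fderiv_fst_apply hw, ← fderiv_snd_apply hw]
  simp only [projHH]
  rw [h2, h3]
  ring

/-- The normal components of the second fundamental form are those of the second derivative. -/
theorem ip_sff (h : IsPatch x U) (hu : u ∈ U) {N : R62} (hN : N ∈ tangentHH (x u))
    (hN' : ∀ v, ip N (fderiv ℝ x u v) = 0) (Y : R2 → R2) {Z : R2 → R2}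
    (hZ : DifferentiableAt ℝ Z u) :
    ip (sff x Y Z u) N = ip (fderiv ℝ (fderiv ℝ x) u (Y u) (Z u)) N := by
  rw [h.sff_eq hu, ip_sub_left, ip_projHH hN, ip_comm (fderiv ℝ x u _), hN', sub_zero,
    fderiv_fderiv_apply (h.smooth u hu) hZ, ip_add_left, ip_comm (fderiv ℝ x u _), hN', add_zero]

/-- Expansion of `∇̄h` into a third derivative of `x`, two curvature terms coming from the
projection to the tangent space of the ambient product, and three terms with Christoffel symbols.
All but the curvature terms are symmetric under exchange of `X` and `Y`, the first and third
Christoffel terms being interchanged. -/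
theorem ip_nablaSff (h : IsPatch x U) (hu : u ∈ U) {N : R62} (hN : N ∈ tangentHH (x u))
    (hN' : ∀ v, ip N (fderiv ℝ x u v) = 0) (X Y Z : R2) :
    ip (nablaSff x (fun _ => X) (fun _ => Y) (fun _ => Z) u) N =
      ip (fderiv ℝ (fderiv ℝ fun y => fderiv ℝ x y Z) u X Y) N
      - mink (fderiv ℝ x u Y).1 (fderiv ℝ x u Z).1 * mink (fderiv ℝ x u X).1 N.1
      - mink (fderiv ℝ x u Y).2 (fderiv ℝ x u Z).2 * mink (fderiv ℝ x u X).2 N.2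
      - ip (fderiv ℝ (fderiv ℝ x) u X (nablaTangent x (fun _ => Y) (fun _ => Z) u)) N
      - ip (fderiv ℝ (fderiv ℝ x) u (nablaTangent x (fun _ => X) (fun _ => Y) u) Z) N
      - ip (fderiv ℝ (fderiv ℝ x) u Y (nablaTangent x (fun _ => X) (fun _ => Z) u)) N := by
  have hx := h.smooth u hu
  have hg : ContDiffAt ℝ ∞ (fun y => fderiv ℝ x y Z) u :=
    contDiffAt_fderiv_apply hx contDiffAt_const
  have hW : ContDiffAt ℝ ∞ (fun y => fderiv ℝ (fun y => fderiv ℝ x y Z) y Y) u :=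
    contDiffAt_fderiv_apply hg contDiffAt_const
  have hΓ : ∀ V W : R2, DifferentiableAt ℝ (nablaTangent x (fun _ => V) (fun _ => W)) u :=
    fun V W => differentiableAt_of_infty
      (h.contDiffAt_nablaTangent hu contDiffAt_const contDiffAt_const)
  have hP : DifferentiableAt ℝ (fun y => projHH (x y)
      (fderiv ℝ (fun y => fderiv ℝ x y Z) y Y)) u :=
    differentiableAt_of_infty (contDiffAt_projHH hx hW)
  have hQ : DifferentiableAt ℝ (fun y => fderiv ℝ x y
      (nablaTangent x (fun _ => Y) (fun _ => Z) y)) u :=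
    (differentiableAt_of_infty (contDiffAt_fderiv hx)).clm_apply (hΓ Y Z)
  have hξ : sff x (fun _ => Y) (fun _ => Z) =ᶠ[𝓝 u] fun y =>
      projHH (x y) (fderiv ℝ (fun y => fderiv ℝ x y Z) y Y) -
        fderiv ℝ x y (nablaTangent x (fun _ => Y) (fun _ => Z) y) :=
    (h.eventually hu).mono fun y hy => h.sff_eq hy _ _
  simp only [nablaSff]
  rw [ip_sub_left, ip_sub_left, h.ip_sff hu hN hN' _ (differentiableAt_const _),
    h.ip_sff hu hN hN' _ (hΓ X Z), nablaNormal, ip_normalPart hN hN', hξ.fderiv_eq,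
    fderiv_fun_sub hP hQ, sub_apply, ip_sub_left,
    ip_fderiv_projHH (h.diff hu) (differentiableAt_of_infty hW) hN,
    fderiv_fderiv_apply hx (hΓ Y Z), ip_add_left, ip_comm (fderiv ℝ x u (fderiv ℝ _ u X)), hN',
    h.mink_fst_second hu (differentiableAt_const Z), h.mink_snd_second hu (differentiableAt_const Z),
    fderiv_fderiv_apply hg (differentiableAt_const Y)]
  simp
  ring

/-- If the second fundamental form is parallel, the tangent planes are curvature invariant. -/
theorem codazzi (h : IsPatch x U) (hu : u ∈ U)
    (hpar : ∀ X Y Z : R2, nablaSff x (fun _ => X) (fun _ => Y) (fun _ => Z) u = 0)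
    {N : R62} (hN : N ∈ tangentHH (x u)) (hN' : ∀ v, ip N (fderiv ℝ x u v) = 0) (X Y Z : R2) :
    mink (fderiv ℝ x u X).1 (fderiv ℝ x u Z).1 * mink N.1 (fderiv ℝ x u Y).1 +
      mink (fderiv ℝ x u X).2 (fderiv ℝ x u Z).2 * mink N.2 (fderiv ℝ x u Y).2 =
    mink (fderiv ℝ x u Y).1 (fderiv ℝ x u Z).1 * mink N.1 (fderiv ℝ x u X).1 +
      mink (fderiv ℝ x u Y).2 (fderiv ℝ x u Z).2 * mink N.2 (fderiv ℝ x u X).2 := by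
  have hx := h.smooth u hu
  have hg : ContDiffAt ℝ ∞ (fun y => fderiv ℝ x y Z) u :=
    contDiffAt_fderiv_apply hx contDiffAt_const
  -- For constant coordinate fields, vanishing torsion is the symmetry of the second derivative.
  have hΓ : nablaTangent x (fun _ => Y) (fun _ => X) u =
      nablaTangent x (fun _ => X) (fun _ => Y) u := by
    simp only [nablaTangent, ambientDeriv]
    rw [fderiv_fderiv_apply hx (differentiableAt_const _),
      fderiv_fderiv_apply hx (differentiableAt_const _), fderiv_fderiv_symm hx]
    simp
  have h1 := h.ip_nablaSff hu hN hN' X Y Z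
  have h2 := h.ip_nablaSff hu hN hN' Y X Z
  rw [hpar, ip_zero_left] at h1 h2
  -- With the third derivatives and the Christoffel terms matched, the difference of the two
  -- expansions is the curvature identity.
  rw [fderiv_fderiv_symm hg Y X, hΓ] at h2
  simp only [mink_comm N.1, mink_comm N.2]
  linear_combination h2 - h1

/-- At each point of a parallel Lagrangian surface, either the tangent plane is a product of lines,
or both factors induce the same metric. -/
theorem dichotomy (h : IsPatch x U) (hu : u ∈ U)
    (hlag : ∀ v w : R2, omega (x u) (fderiv ℝ x u v) (fderiv ℝ x u w) = 0)
    (hpar : ∀ X Y Z : R2, nablaSff x (fun _ => X) (fun _ => Y) (fun _ => Z) u = 0) :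
    (∀ v w : R2, mink (lcross (x u).1 (fderiv ℝ x u v).1) (fderiv ℝ x u w).1 = 0) ∨
    (∀ v w : R2, mink (fderiv ℝ x u v).1 (fderiv ℝ x u w).1 =
      mink (fderiv ℝ x u v).2 (fderiv ℝ x u w).2) := by
  by_contra! hcon
  obtain ⟨⟨X, Y, hXY⟩, Z, W, hZW⟩ := hcon
  have hN : J (x u) (fderiv ℝ x u W) ∈ tangentHH (x u) := by
    constructor
    · exact mink_lcross_self_left _ _
    · simp only [J, mink_neg_left, mink_lcross_self_left, neg_zero]
  -- The Lagrangian condition says exactly that `JW` is normal.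
  have h1 := h.codazzi hu hpar hN (fun v => hlag W v) X Y Z
  have h2 := hlag X Y
  have h3 := area_identity (X := (fderiv ℝ x u X).1) (Y := (fderiv ℝ x u Y).1)
    (W := (fderiv ℝ x u W).1) (h.fderiv_mem hu Z).1
  have h4 := area_identity (X := (fderiv ℝ x u X).2) (Y := (fderiv ℝ x u Y).2)
    (W := (fderiv ℝ x u W).2) (h.fderiv_mem hu Z).2
  simp only [omega, ip, J, mink_neg_left] at h1 h2
  refine mul_ne_zero hXY (sub_ne_zero.2 hZW) ?_
  -- The sign of `J` on the second factor makes Codazzi read `ω₁(X,Y) g₁(Z,W) = ω₂(X,Y) g₂(Z,W)`;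
  -- `h2` replaces `ω₂` by `ω₁`.
  linear_combination h1 - h3 + h4 - h2 * mink (fderiv ℝ x u Z).2 (fderiv ℝ x u W).2

end IsPatch

/-! ### Surfaces whose projections to the two factors are curves -/

/-- `n` is a unit normal, with curvature `κ`, along the map `y` of rank at most one into `ℍ²`. -/
structure IsCurveFrame (y n : R2 → R31) (κ : R2 → ℝ) (U : Set R2) : Prop where
  diff : ∀ u ∈ U, DifferentiableAt ℝ n u
  diff_curv : ∀ u ∈ U, DifferentiableAt ℝ κ u
  norm : ∀ u ∈ U, mink (n u) (n u) = 1
  orth : ∀ u ∈ U, mink (n u) (y u) = 0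
  tangent : ∀ u ∈ U, ∀ v, mink (n u) (fderiv ℝ y u v) = 0
  deriv : ∀ u ∈ U, ∀ v, fderiv ℝ n u v = -κ u • fderiv ℝ y u v

namespace IsPatch

variable {x : R2 → R62} {U : Set R2} {u : R2} {n₁ n₂ : R2 → R31} {κ₁ κ₂ : R2 → ℝ}

theorem eq_smul_of_normal {y n v : R31} (hy : y ∈ hyp (-1)) (hn : mink n n = 1)
    (hny : mink n y = 0) (hv : mink v y = 0) (hvn : mink n v = 0) :
    v = mink v (lcross n y) • lcross n y := by
  have h := frame_expansion hy hn hny v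
  rwa [hv, mink_comm v n, hvn, neg_zero, zero_smul, zero_smul, zero_add, add_zero] at h

/-- Each component of `dx` is a multiple of the unit tangent `nᵢ ⊠ xᵢ`. The two coefficients form an
injective map from the plane to `ℝ²`, hence a bijection, so the tangent plane is a product of lines.
-/
theorem fderiv_surj_of_frames (h : IsPatch x U) (hu : u ∈ U)
    (h₁ : IsCurveFrame (fun y => (x y).1) n₁ κ₁ U) (h₂ : IsCurveFrame (fun y => (x y).2) n₂ κ₂ U)
    (a b : ℝ) : ∃ v, fderiv ℝ x u v =
      (a • lcross (n₁ u) (x u).1, b • lcross (n₂ u) (x u).2) := by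
  have e1 : ∀ v, (fderiv ℝ x u v).1 =
      mink (fderiv ℝ x u v).1 (lcross (n₁ u) (x u).1) • lcross (n₁ u) (x u).1 := fun v =>
    eq_smul_of_normal (h.mem u hu).1 (h₁.norm u hu) (h₁.orth u hu) (h.fderiv_mem hu v).1
      (by rw [← fderiv_fst_apply (h.diff hu)]; exact h₁.tangent u hu v)
  have e2 : ∀ v, (fderiv ℝ x u v).2 =
      mink (fderiv ℝ x u v).2 (lcross (n₂ u) (x u).2) • lcross (n₂ u) (x u).2 := fun v =>
    eq_smul_of_normal (h.mem u hu).2 (h₂.norm u hu) (h₂.orth u hu) (h.fderiv_mem hu v).2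
      (by rw [← fderiv_snd_apply (h.diff hu)]; exact h₂.tangent u hu v)
  let T : R2 →ₗ[ℝ] ℝ × ℝ := LinearMap.prod
    ((minkL (lcross (n₁ u) (x u).1)).toLinearMap ∘ₗ LinearMap.fst ℝ R31 R31 ∘ₗ
      (fderiv ℝ x u).toLinearMap)
    ((minkL (lcross (n₂ u) (x u).2)).toLinearMap ∘ₗ LinearMap.snd ℝ R31 R31 ∘ₗ
      (fderiv ℝ x u).toLinearMap)
  have hT : ∀ v, T v = (mink (fderiv ℝ x u v).1 (lcross (n₁ u) (x u).1),
      mink (fderiv ℝ x u v).2 (lcross (n₂ u) (x u).2)) := fun v =>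
    Prod.ext (mink_comm _ _) (mink_comm _ _)
  have hinj : Function.Injective T := by
    rw [injective_iff_map_eq_zero]
    intro v hv
    rw [hT, Prod.mk_eq_zero] at hv
    refine h.inj u hu ?_
    rw [map_zero]
    exact Prod.ext (by rw [e1, hv.1, zero_smul]; rfl) (by rw [e2, hv.2, zero_smul]; rfl)
  obtain ⟨v, hv⟩ := (LinearMap.injective_iff_surjective_of_finrank_eq_finrank
    (by simp)).1 hinj (a, b)
  rw [hT, Prod.mk.injEq] at hv
  exact ⟨v, Prod.ext (by rw [e1, hv.1]) (by rw [e2, hv.2])⟩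

/-- The vectors `(n₁, 0)` and `(0, n₂)` are an orthonormal basis of the normal plane. In
`frame_expansion` the radial and tangential coefficients of the normal part vanish. -/
theorem normalPart_of_frames (h : IsPatch x U) (hu : u ∈ U)
    (h₁ : IsCurveFrame (fun y => (x y).1) n₁ κ₁ U) (h₂ : IsCurveFrame (fun y => (x y).2) n₂ κ₂ U)
    (w : R62) :
    normalPart x u w = (mink w.1 (n₁ u) • n₁ u, mink w.2 (n₂ u) • n₂ u) := by
  have hm := h.normalPart_mem hu w
  have hT := h.ip_normalPart_fderiv hu w
  have hN₁ := ip_normalPart (x := x) (u := u) (N := (n₁ u, 0)) ⟨h₁.orth u hu, by simp⟩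
    (fun v => by
      have := h₁.tangent u hu v
      rw [fderiv_fst_apply (h.diff hu)] at this
      simpa [ip] using this) w
  have hN₂ := ip_normalPart (x := x) (u := u) (N := (0, n₂ u)) ⟨by simp, h₂.orth u hu⟩
    (fun v => by
      have := h₂.tangent u hu v
      rw [fderiv_snd_apply (h.diff hu)] at this
      simpa [ip] using this) w
  obtain ⟨v₁, hv₁⟩ := h.fderiv_surj_of_frames hu h₁ h₂ 1 0
  obtain ⟨v₂, hv₂⟩ := h.fderiv_surj_of_frames hu h₁ h₂ 0 1
  have t1 := hT v₁
  have t2 := hT v₂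
  rw [hv₁] at t1
  rw [hv₂] at t2
  simp only [ip, one_smul, zero_smul, mink_zero_right, add_zero, zero_add] at t1 t2 hN₁ hN₂
  refine Prod.ext ?_ ?_
  · rw [frame_expansion (h.mem u hu).1 (h₁.norm u hu) (h₁.orth u hu) (normalPart x u w).1, hm.1,
      t1, hN₁]
    simp
  · rw [frame_expansion (h.mem u hu).2 (h₂.norm u hu) (h₂.orth u hu) (normalPart x u w).2, hm.2,
      t2, hN₂]
    simp

/-- Differentiate `⟨dx(Z), n⟩ = 0` and insert `dn = -κ dx`. -/
theorem mink_fst_frame (h : IsPatch x U) (hu : u ∈ U)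
    (h₁ : IsCurveFrame (fun y => (x y).1) n₁ κ₁ U) {Z : R2 → R2} (hZ : DifferentiableAt ℝ Z u)
    (v : R2) : mink (fderiv ℝ (fun y => fderiv ℝ x y (Z y)) u v).1 (n₁ u) =
      κ₁ u * mink (fderiv ℝ x u v).1 (fderiv ℝ x u (Z u)).1 := by
  have hd : DifferentiableAt ℝ (fun y => fderiv ℝ x y (Z y)) u :=
    (differentiableAt_of_infty (contDiffAt_fderiv (h.smooth u hu))).clm_apply hZ
  rw [← fderiv_fst_apply hd, mink_fderiv_of_eventually_eq (c := 0) hd.fst (h₁.diff u hu)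
    ((h.eventually hu).mono fun y hy => by
      rw [mink_comm, ← fderiv_fst_apply (h.diff hy)]; exact h₁.tangent y hy _),
    h₁.deriv u hu, fderiv_fst_apply (h.diff hu), mink_smul_right, mink_comm]
  ring

theorem mink_snd_frame (h : IsPatch x U) (hu : u ∈ U)
    (h₂ : IsCurveFrame (fun y => (x y).2) n₂ κ₂ U) {Z : R2 → R2} (hZ : DifferentiableAt ℝ Z u)
    (v : R2) : mink (fderiv ℝ (fun y => fderiv ℝ x y (Z y)) u v).2 (n₂ u) =
      κ₂ u * mink (fderiv ℝ x u v).2 (fderiv ℝ x u (Z u)).2 := by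
  have hd : DifferentiableAt ℝ (fun y => fderiv ℝ x y (Z y)) u :=
    (differentiableAt_of_infty (contDiffAt_fderiv (h.smooth u hu))).clm_apply hZ
  rw [← fderiv_snd_apply hd, mink_fderiv_of_eventually_eq (c := 0) hd.snd (h₂.diff u hu)
    ((h.eventually hu).mono fun y hy => by
      rw [mink_comm, ← fderiv_snd_apply (h.diff hy)]; exact h₂.tangent y hy _),
    h₂.deriv u hu, fderiv_snd_apply (h.diff hu), mink_smul_right, mink_comm]
  ring

theorem sff_of_frames (h : IsPatch x U) (hu : u ∈ U)
    (h₁ : IsCurveFrame (fun y => (x y).1) n₁ κ₁ U) (h₂ : IsCurveFrame (fun y => (x y).2) n₂ κ₂ U)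
    (Y : R2 → R2) {Z : R2 → R2} (hZ : DifferentiableAt ℝ Z u) :
    sff x Y Z u = ((κ₁ u * mink (fderiv ℝ x u (Y u)).1 (fderiv ℝ x u (Z u)).1) • n₁ u,
      (κ₂ u * mink (fderiv ℝ x u (Y u)).2 (fderiv ℝ x u (Z u)).2) • n₂ u) := by
  rw [sff, h.normalPart_of_frames hu h₁ h₂]
  simp only [ambientDeriv, projHH, mink_add_left, mink_smul_left, h.mink_fst_frame hu h₁ hZ,
    h.mink_snd_frame hu h₂ hZ, mink_comm (x u).1, mink_comm (x u).2, h₁.orth u hu, h₂.orth u hu,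
    mul_zero, add_zero]

/-- The tangential part is characterized only by the sum of the two inner products. It is compatible
with each factor separately because `h` is a multiple of `nᵢ` in the `i`-th factor, hence orthogonal
to `dxᵢ`. -/
theorem mink_nablaTangent (h : IsPatch x U) (hu : u ∈ U)
    (h₁ : IsCurveFrame (fun y => (x y).1) n₁ κ₁ U) (h₂ : IsCurveFrame (fun y => (x y).2) n₂ κ₂ U)
    (Y : R2 → R2) {Z : R2 → R2} (hZ : DifferentiableAt ℝ Z u) (v : R2) :
    mink (fderiv ℝ x u (nablaTangent x Y Z u)).1 (fderiv ℝ x u v).1 =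
      mink (fderiv ℝ (fun y => fderiv ℝ x y (Z y)) u (Y u)).1 (fderiv ℝ x u v).1 ∧
    mink (fderiv ℝ x u (nablaTangent x Y Z u)).2 (fderiv ℝ x u v).2 =
      mink (fderiv ℝ (fun y => fderiv ℝ x y (Z y)) u (Y u)).2 (fderiv ℝ x u v).2 := by
  have e := h.sff_eq hu Y Z
  rw [h.sff_of_frames hu h₁ h₂ Y hZ, eq_sub_iff_add_eq, ← eq_sub_iff_add_eq'] at e
  have o1 := h₁.tangent u hu v
  have o2 := h₂.tangent u hu v
  have t := h.fderiv_mem hu v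
  rw [fderiv_fst_apply (h.diff hu)] at o1
  rw [fderiv_snd_apply (h.diff hu)] at o2
  rw [e]
  simp [projHH, mink_sub_left, mink_add_left, mink_smul_left, o1, o2, mink_comm (x u).1,
    mink_comm (x u).2, t.1, t.2]

/-- The derivative of the second fundamental form of a product of curves only involves the
derivatives of the curvatures. -/
theorem nablaSff_of_frames (h : IsPatch x U) (hu : u ∈ U)
    (h₁ : IsCurveFrame (fun y => (x y).1) n₁ κ₁ U) (h₂ : IsCurveFrame (fun y => (x y).2) n₂ κ₂ U)
    {X Y Z : R2 → R2} (hX : ContDiffOn ℝ ∞ X U) (hY : ContDiffOn ℝ ∞ Y U)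
    (hZ : ContDiffOn ℝ ∞ Z U) :
    nablaSff x X Y Z u =
      ((fderiv ℝ κ₁ u (X u) * mink (fderiv ℝ x u (Y u)).1 (fderiv ℝ x u (Z u)).1) • n₁ u,
       (fderiv ℝ κ₂ u (X u) * mink (fderiv ℝ x u (Y u)).2 (fderiv ℝ x u (Z u)).2) • n₂ u) := by
  have hX' := fun y hy => hX.contDiffAt (h.isOpen.mem_nhds (x := y) hy)
  have hY' := fun y hy => hY.contDiffAt (h.isOpen.mem_nhds (x := y) hy)
  have hZ' := fun y hy => hZ.contDiffAt (h.isOpen.mem_nhds (x := y) hy)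
  have dY := fun y hy => differentiableAt_of_infty (hY' y hy)
  have dZ := fun y hy => differentiableAt_of_infty (hZ' y hy)
  have hξ : sff x Y Z =ᶠ[𝓝 u] fun y =>
      ((κ₁ y * mink (fderiv ℝ x y (Y y)).1 (fderiv ℝ x y (Z y)).1) • n₁ y,
      (κ₂ y * mink (fderiv ℝ x y (Y y)).2 (fderiv ℝ x y (Z y)).2) • n₂ y) :=
    (h.eventually hu).mono fun y hy => h.sff_of_frames hy h₁ h₂ Y (dZ y hy)
  have DY : DifferentiableAt ℝ (fun y => fderiv ℝ x y (Y y)) u :=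
    (differentiableAt_of_infty (contDiffAt_fderiv (h.smooth u hu))).clm_apply (dY u hu)
  have DZ : DifferentiableAt ℝ (fun y => fderiv ℝ x y (Z y)) u :=
    (differentiableAt_of_infty (contDiffAt_fderiv (h.smooth u hu))).clm_apply (dZ u hu)
  have dg1 := differentiableAt_mink DY.fst DZ.fst
  have dg2 := differentiableAt_mink DY.snd DZ.snd
  have df1 := (h₁.diff_curv u hu).fun_mul dg1
  have df2 := (h₂.diff_curv u hu).fun_mul dg2
  have dN1 := df1.fun_smul (h₁.diff u hu)
  have dN2 := df2.fun_smul (h₂.diff u hu)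
  -- A unit normal contributes nothing here because `⟨dn, n⟩ = 0`; thus `∇^⊥` acts on the
  -- coefficients alone.
  have key : ∀ {f : R2 → ℝ} {n : R2 → R31}, DifferentiableAt ℝ f u → DifferentiableAt ℝ n u →
      (∀ y ∈ U, mink (n y) (n y) = 1) → ∀ v,
      mink (fderiv ℝ (fun y => f y • n y) u v) (n u) = fderiv ℝ f u v := by
    intro f n hf hn hnn v
    rw [fderiv_fun_smul hf hn]
    simp [mink_add_left, mink_smul_left, hnn u hu,
      mink_fderiv_self_of_eventually_eq hn ((h.eventually hu).mono hnn)]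
  have dΓ : DifferentiableAt ℝ (nablaTangent x X Z) u :=
    differentiableAt_of_infty (h.contDiffAt_nablaTangent hu (hX' u hu) (hZ' u hu))
  have m1 := h.mink_nablaTangent hu h₁ h₂ X (dY u hu) (Z u)
  have m2 := h.mink_nablaTangent hu h₁ h₂ X (dZ u hu) (Y u)
  rw [nablaSff, nablaNormal, h.normalPart_of_frames hu h₁ h₂, hξ.fderiv_eq,
    ← fderiv_fst_apply (dN1.prodMk dN2), ← fderiv_snd_apply (dN1.prodMk dN2)]
  simp only [key df1 (h₁.diff u hu) h₁.norm, key df2 (h₂.diff u hu) h₂.norm]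
  rw [h.sff_of_frames hu h₁ h₂ _ (dZ u hu), h.sff_of_frames hu h₁ h₂ _ dΓ,
    fderiv_fun_mul (h₁.diff_curv u hu) dg1, fderiv_fun_mul (h₂.diff_curv u hu) dg2]
  simp only [add_apply, smul_apply, smul_eq_mul, fderiv_mink DY.fst DZ.fst,
    fderiv_mink DY.snd DZ.snd, fderiv_fst_apply DY, fderiv_fst_apply DZ, fderiv_snd_apply DY,
    fderiv_snd_apply DZ, m1.1, m1.2, mink_comm _ (fderiv ℝ x u (nablaTangent x X Z u)).1,
    mink_comm _ (fderiv ℝ x u (nablaTangent x X Z u)).2, m2.1, m2.2, Prod.mk_sub_mk, ← sub_smul]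
  refine Prod.ext ?_ ?_
  · simp only [mink_comm (fderiv ℝ x u (Y u)).1 (fderiv ℝ (fun y => fderiv ℝ x y (Z y)) u (X u)).1]
    congr 1
    ring
  · simp only [mink_comm (fderiv ℝ x u (Y u)).2 (fderiv ℝ (fun y => fderiv ℝ x y (Z y)) u (X u)).2]
    congr 1
    ring

end IsPatch

/-! ### Existence of curve frames and constancy of the curvatures -/

/-- Vanishing area makes the images of the two basis vectors parallel, so the rank is at most one.
-/
theorem exists_ne_zero_map_eq_zero {y : R31} (hy : y ∈ hyp (-1)) (L : R2 →ₗ[ℝ] R31)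
    (hL : ∀ v, mink (L v) y = 0) (hω : ∀ v w, mink (lcross y (L v)) (L w) = 0) :
    ∃ v, v ≠ 0 ∧ L v = 0 := by
  by_cases h0 : L (EuclideanSpace.single 0 1) = 0
  · exact ⟨_, by simp, h0⟩
  · refine ⟨EuclideanSpace.single 1 1 - (mink (L (EuclideanSpace.single 1 1))
      (L (EuclideanSpace.single 0 1)) / mink (L (EuclideanSpace.single 0 1))
      (L (EuclideanSpace.single 0 1))) • EuclideanSpace.single 0 1, fun h => ?_, ?_⟩
    · simpa using congrArg (fun z : R2 => z 1) h
    · rw [map_sub, map_smul, sub_eq_zero]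
      exact parallel_of_area_eq_zero hy (hL _) (hL _) h0 (hω _ _)

/-- The normal is `y ⊠ dy(v₀)` normalized, and rank one makes it orthogonal to every `dy(v)`. The
Weingarten relation `dn = -κ dy` is checked against the basis `y`, `dy(v₀)`, `n`. -/
theorem exists_curveFrame {y : R2 → R31} {U : Set R2} (hU : IsOpen U)
    (hs : ∀ u ∈ U, ContDiffAt ℝ ∞ y u) (hm : ∀ u ∈ U, y u ∈ hyp (-1))
    (hω : ∀ u ∈ U, ∀ v w, mink (lcross (y u) (fderiv ℝ y u v)) (fderiv ℝ y u w) = 0)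
    {u₀ : R2} (hu₀ : u₀ ∈ U) {v₀ : R2} (hv₀ : fderiv ℝ y u₀ v₀ ≠ 0) :
    ∃ U' ⊆ U, IsOpen U' ∧ u₀ ∈ U' ∧ ∃ n κ, IsCurveFrame y n κ U' := by
  have hds : ∀ u ∈ U, ∀ v, ContDiffAt ℝ ∞ (fun z => fderiv ℝ y z v) u := fun u hu v =>
    contDiffAt_fderiv_apply (hs u hu) contDiffAt_const
  have hUn : ∀ u ∈ U, ∀ᶠ z in 𝓝 u, z ∈ U := fun u hu => hU.mem_nhds hu
  have hev : ∀ᶠ u in 𝓝 u₀, u ∈ U ∧ fderiv ℝ y u v₀ ≠ 0 :=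
    (hUn u₀ hu₀).and ((hds u₀ hu₀ v₀).continuousAt.eventually_ne hv₀)
  obtain ⟨U', hU', hU'o, hu₀'⟩ := eventually_nhds_iff.1 hev
  have hsub : U' ⊆ U := fun u hu => (hU' u hu).1
  have hty : ∀ u ∈ U', ∀ v, mink (fderiv ℝ y u v) (y u) = 0 := fun u hu v =>
    mink_fderiv_self_of_eventually_eq (differentiableAt_of_infty (hs u (hsub hu)))
      ((hUn u (hsub hu)).mono fun z hz => mink_self_of_mem (hm z hz)) v
  set r : R2 → ℝ := fun u => mink (fderiv ℝ y u v₀) (fderiv ℝ y u v₀) with hr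
  have hrpos : ∀ u ∈ U', 0 < r u := fun u hu =>
    mink_self_pos (hm u (hsub hu)) (hty u hu v₀) (hU' u hu).2
  have hrs : ∀ u ∈ U', ContDiffAt ℝ ∞ r u := fun u hu =>
    contDiffAt_mink (hds u (hsub hu) v₀) (hds u (hsub hu) v₀)
  set n : R2 → R31 := fun u => (√(r u))⁻¹ • lcross (y u) (fderiv ℝ y u v₀) with hn
  have hns : ∀ u ∈ U', ContDiffAt ℝ ∞ n u := fun u hu =>
    (((hrs u hu).sqrt (hrpos u hu).ne').inv (Real.sqrt_pos.2 (hrpos u hu)).ne').smul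
      (contDiffAt_lcross (hs u (hsub hu)) (hds u (hsub hu) v₀))
  have hnd := fun u hu => differentiableAt_of_infty (hns u hu)
  have hyd := fun u hu => differentiableAt_of_infty (hs u hu)
  -- The value forced by `dn = -κ dy` in the direction `v₀`.
  set κ : R2 → ℝ := fun u => -mink (fderiv ℝ n u v₀) (fderiv ℝ y u v₀) / r u with hκ
  have hκs : ∀ u ∈ U', ContDiffAt ℝ ∞ κ u := fun u hu =>
    (contDiffAt_mink (contDiffAt_fderiv_apply (hns u hu) contDiffAt_const)
      (hds u (hsub hu) v₀)).neg.div (hrs u hu) (hrpos u hu).ne'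
  have hnorm : ∀ u ∈ U', mink (n u) (n u) = 1 := by
    intro u hu
    have h1 := hrpos u hu
    simp only [hn, mink_smul_left, mink_smul_right,
      mink_lcross_self_of_mem (hm u (hsub hu)) (hty u hu v₀)]
    change (√(r u))⁻¹ * ((√(r u))⁻¹ * r u) = 1
    have h2 := Real.mul_self_sqrt h1.le
    have h3 := (Real.sqrt_pos.2 h1).ne'
    field_simp
    rw [sq, h2]
  have horth : ∀ u ∈ U', mink (n u) (y u) = 0 := fun u hu => by
    simp only [hn, mink_smul_left, mink_lcross_self_left, mul_zero]
  have htan : ∀ u ∈ U', ∀ v, mink (n u) (fderiv ℝ y u v) = 0 := fun u hu v => by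
    simp only [hn, mink_smul_left, hω u (hsub hu), mul_zero]
  refine ⟨U', hsub, hU'o, hu₀', n, κ, hnd, fun u hu => differentiableAt_of_infty (hκs u hu),
    hnorm, horth, htan, fun u hu w => ?_⟩
  have hnear : ∀ᶠ z in 𝓝 u, z ∈ U' := hU'o.mem_nhds hu
  have hsymm : ∀ a b, mink (fderiv ℝ n u a) (fderiv ℝ y u b) =
      -mink (n u) (fderiv ℝ (fderiv ℝ y) u a b) := by
    intro a b
    have h1 := mink_fderiv_of_eventually_eq (g := fun z => fderiv ℝ y z b) (hnd u hu)
      (differentiableAt_of_infty (hds u (hsub hu) b)) (hnear.mono fun z hz => htan z hz b) a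
    rw [h1, fderiv_fderiv_apply (hs u (hsub hu)) (differentiableAt_const b)]
    simp
  have h1 : mink (fderiv ℝ n u w) (y u) = 0 := by
    rw [mink_fderiv_of_eventually_eq (hnd u hu) (hyd u (hsub hu)) (hnear.mono horth),
      htan u hu, neg_zero]
  have h2 : mink (fderiv ℝ n u w) (n u) = 0 :=
    mink_fderiv_self_of_eventually_eq (hnd u hu) (hnear.mono hnorm) w
  -- The form `⟨dn(a), dy(b)⟩` is symmetric, so `w` can be moved to the argument of `dy`, where
  -- `dy(w)` is a multiple of `dy(v₀)`. In particular `dn` vanishes where `dy` does.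
  have h3 : mink (fderiv ℝ n u w) (fderiv ℝ y u v₀) =
      -κ u * mink (fderiv ℝ y u w) (fderiv ℝ y u v₀) := by
    have h4 := parallel_of_area_eq_zero (hm u (hsub hu)) (hty u hu v₀) (hty u hu w)
      (hU' u hu).2 (hω u (hsub hu) v₀ w)
    rw [hsymm, fderiv_fderiv_symm (hs u (hsub hu)), ← hsymm]
    conv_lhs => rw [h4, mink_smul_right]
    simp only [hκ, hr]
    ring
  rw [← sub_eq_zero]
  refine eq_zero_of_mink_eq_zero (a := y u) (b := fderiv ℝ y u v₀) (c := n u) ?_ ?_ ?_ ?_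
  · simp only [hn, mink_smul_right, mink_lcross_self_of_mem (hm u (hsub hu)) (hty u hu v₀)]
    exact (mul_pos (inv_pos.2 (Real.sqrt_pos.2 (hrpos u hu))) (hrpos u hu)).ne'
  · rw [mink_sub_left, mink_smul_left, h1, hty u hu]; ring
  · rw [mink_sub_left, mink_smul_left, h3]; ring
  · rw [mink_sub_left, mink_smul_left, h2, mink_comm (fderiv ℝ y u w), htan u hu]; ring

theorem IsCurveFrame.mono {y n : R2 → R31} {κ : R2 → ℝ} {U V : Set R2}
    (h : IsCurveFrame y n κ U) (hV : V ⊆ U) : IsCurveFrame y n κ V :=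
  ⟨fun u hu => h.diff u (hV hu), fun u hu => h.diff_curv u (hV hu),
    fun u hu => h.norm u (hV hu), fun u hu => h.orth u (hV hu),
    fun u hu => h.tangent u (hV hu), fun u hu => h.deriv u (hV hu)⟩

theorem eventually_eq_of_fderiv_eq_zero {E F : Type*} [NormedAddCommGroup E] [NormedSpace ℝ E]
    [NormedAddCommGroup F] [NormedSpace ℝ F] {f : E → F} {u₀ : E}
    (h : ∀ᶠ u in 𝓝 u₀, DifferentiableAt ℝ f u ∧ fderiv ℝ f u = 0) :
    ∀ᶠ u in 𝓝 u₀, f u = f u₀ := by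
  obtain ⟨ε, hε, hb⟩ := Metric.eventually_nhds_iff_ball.1 h
  filter_upwards [Metric.ball_mem_nhds u₀ hε] with u hu
  exact Metric.isOpen_ball.is_const_of_fderiv_eq_zero (convex_ball u₀ ε).isPreconnected
    (fun z hz => (hb z hz).1.differentiableWithinAt) (fun z hz => (hb z hz).2) hu
    (Metric.mem_ball_self hε)

/-- Near `u₀` the map `y` takes values in the curve `⟨y, a⟩ = -κ` of curvature `κ`. -/
def InCurve (y : R2 → R31) (u₀ : R2) (a : R31) (κ : ℝ) : Prop :=
  mink a a = 1 - κ ^ 2 ∧ ∀ᶠ u in 𝓝 u₀, mink (y u) a = -κ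

/-- When `dκ = 0`, the derivative of `n + κ y` is `-κ dy + κ dy = 0`. Pairing this constant vector
with `y` and with itself gives the plane and the norm. -/
theorem IsCurveFrame.inCurve {y n : R2 → R31} {κ : R2 → ℝ} {U : Set R2}
    (h : IsCurveFrame y n κ U) (hU : IsOpen U) (hy : ∀ u ∈ U, DifferentiableAt ℝ y u)
    (hm : ∀ u ∈ U, y u ∈ hyp (-1)) (hκ : ∀ u ∈ U, fderiv ℝ κ u = 0) {u₀ : R2} (hu₀ : u₀ ∈ U) :
    InCurve y u₀ (n u₀ + κ u₀ • y u₀) (κ u₀) := by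
  have hnear : ∀ᶠ u in 𝓝 u₀, u ∈ U := hU.mem_nhds hu₀
  have h1 : ∀ᶠ u in 𝓝 u₀, κ u = κ u₀ :=
    eventually_eq_of_fderiv_eq_zero (hnear.mono fun u hu => ⟨h.diff_curv u hu, hκ u hu⟩)
  have h2 : ∀ᶠ u in 𝓝 u₀, n u + κ u • y u = n u₀ + κ u₀ • y u₀ := by
    refine eventually_eq_of_fderiv_eq_zero (f := fun u => n u + κ u • y u)
      (hnear.mono fun u hu => ⟨(h.diff u hu).add ((h.diff_curv u hu).fun_smul (hy u hu)), ?_⟩)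
    rw [fderiv_fun_add (h.diff u hu) ((h.diff_curv u hu).fun_smul (hy u hu)),
      fderiv_fun_smul (h.diff_curv u hu) (hy u hu), hκ u hu]
    ext1 v
    simp [h.deriv u hu]
  constructor
  · simp only [mink_add_left, mink_add_right, mink_smul_left, mink_smul_right, h.norm u₀ hu₀,
      h.orth u₀ hu₀, mink_comm (y u₀) (n u₀), mink_self_of_mem (hm u₀ hu₀)]
    ring
  · filter_upwards [h1, h2, hnear] with u e1 e2 hu
    rw [← e2, ← e1, mink_add_right, mink_smul_right, mink_comm, h.orth u hu,
      mink_self_of_mem (hm u hu)]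
    ring

namespace IsPatch

variable {x : R2 → R62} {U : Set R2} {u : R2}

theorem mono (h : IsPatch x U) {V : Set R2} (hV : V ⊆ U) (hVo : IsOpen V) : IsPatch x V :=
  ⟨hVo, fun u hu => h.smooth u (hV hu), fun u hu => h.mem u (hV hu), fun u hu => h.inj u (hV hu)⟩

/-- A kernel vector of the second component cannot also be killed by the first, since `dx` is
injective. -/
theorem exists_fst_ne_zero (h : IsPatch x U) (hu : u ∈ U)
    (hω : ∀ v w, mink (lcross (x u).2 (fderiv ℝ x u v).2) (fderiv ℝ x u w).2 = 0) :
    ∃ v, (fderiv ℝ x u v).1 ≠ 0 := by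
  obtain ⟨v, hv, h0⟩ := exists_ne_zero_map_eq_zero (h.mem u hu).2
    (LinearMap.snd ℝ R31 R31 ∘ₗ (fderiv ℝ x u).toLinearMap) (fun v => (h.fderiv_mem hu v).2) hω
  exact ⟨v, fun h1 => hv (h.inj u hu ((Prod.ext h1 h0 : fderiv ℝ x u v = 0).trans
    (map_zero _).symm))⟩

theorem exists_snd_ne_zero (h : IsPatch x U) (hu : u ∈ U)
    (hω : ∀ v w, mink (lcross (x u).1 (fderiv ℝ x u v).1) (fderiv ℝ x u w).1 = 0) :
    ∃ v, (fderiv ℝ x u v).2 ≠ 0 := by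
  obtain ⟨v, hv, h0⟩ := exists_ne_zero_map_eq_zero (h.mem u hu).1
    (LinearMap.fst ℝ R31 R31 ∘ₗ (fderiv ℝ x u).toLinearMap) (fun v => (h.fderiv_mem hu v).1) hω
  exact ⟨v, fun h1 => hv (h.inj u hu ((Prod.ext h0 h1 : fderiv ℝ x u v = 0).trans
    (map_zero _).symm))⟩

/-- A parallel surface with product tangent planes is locally a product of curves of constant
curvature. -/
theorem exists_inCurve (h : IsPatch x U)
    (hω₁ : ∀ u ∈ U, ∀ v w, mink (lcross (x u).1 (fderiv ℝ x u v).1) (fderiv ℝ x u w).1 = 0)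
    (hω₂ : ∀ u ∈ U, ∀ v w, mink (lcross (x u).2 (fderiv ℝ x u v).2) (fderiv ℝ x u w).2 = 0)
    (hpar : ∀ u ∈ U, ∀ X Y Z : R2, nablaSff x (fun _ => X) (fun _ => Y) (fun _ => Z) u = 0)
    (hu : u ∈ U) :
    (∃ a κ, InCurve (fun y => (x y).1) u a κ) ∧ (∃ a κ, InCurve (fun y => (x y).2) u a κ) := by
  obtain ⟨v₁, hv₁⟩ := h.exists_fst_ne_zero hu (hω₂ u hu)
  obtain ⟨v₂, hv₂⟩ := h.exists_snd_ne_zero hu (hω₁ u hu)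
  obtain ⟨U₁, hU₁, hU₁o, hu₁, n₁, κ₁, h₁⟩ := exists_curveFrame h.isOpen (y := fun y => (x y).1)
    (fun u hu => (h.smooth u hu).fst) (fun u hu => (h.mem u hu).1)
    (fun u hu v w => by simp only [fderiv_fst_apply (h.diff hu), hω₁ u hu]) hu
    (v₀ := v₁) (by rwa [fderiv_fst_apply (h.diff hu)])
  obtain ⟨U₂, hU₂, hU₂o, hu₂, n₂, κ₂, h₂⟩ := exists_curveFrame h.isOpen (y := fun y => (x y).2)
    (fun u hu => (h.smooth u hu).snd) (fun u hu => (h.mem u hu).2)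
    (fun u hu v w => by simp only [fderiv_snd_apply (h.diff hu), hω₂ u hu]) hu
    (v₀ := v₂) (by rwa [fderiv_snd_apply (h.diff hu)])
  have hV : IsOpen (U₁ ∩ U₂) := hU₁o.inter hU₂o
  have hVU : U₁ ∩ U₂ ⊆ U := fun z hz => hU₁ hz.1
  replace h₁ := h₁.mono (V := U₁ ∩ U₂) inter_subset_left
  replace h₂ := h₂.mono (V := U₁ ∩ U₂) inter_subset_right
  have hP := h.mono hVU hV
  have hne : ∀ {y n : R31}, y ∈ hyp (-1) → mink n n = 1 → mink n y = 0 →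
      mink (lcross n y) (lcross n y) = 1 := by
    intro y n hy hn hny
    rw [mink_lcross_lcross, mink_self_of_mem hy, hn, hny]; ring
  have hn0 : ∀ {n : R31} {r : ℝ}, mink n n = 1 → r • n = 0 → r = 0 := by
    intro n r hn hr
    simpa [mink_smul_left, hn] using congrArg (fun z => mink z n) hr
  -- Take `Y = Z = v` with `dx(v)` the unit tangent of the first factor: the first component of
  -- `∇̄h` is then `dκ₁(w) n₁`.
  have hκ₁ : ∀ z ∈ U₁ ∩ U₂, fderiv ℝ κ₁ z = 0 := by
    intro z hz
    ext1 w
    obtain ⟨v, hv⟩ := hP.fderiv_surj_of_frames hz h₁ h₂ 1 0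
    have e := hpar z (hVU hz) w v v
    rw [hP.nablaSff_of_frames hz h₁ h₂ contDiffOn_const contDiffOn_const contDiffOn_const, hv,
      Prod.mk_eq_zero] at e
    have e1 := hn0 (h₁.norm z hz) e.1
    simpa [hne (hP.mem z hz).1 (h₁.norm z hz) (h₁.orth z hz)] using e1
  have hκ₂ : ∀ z ∈ U₁ ∩ U₂, fderiv ℝ κ₂ z = 0 := by
    intro z hz
    ext1 w
    obtain ⟨v, hv⟩ := hP.fderiv_surj_of_frames hz h₁ h₂ 0 1
    have e := hpar z (hVU hz) w v v
    rw [hP.nablaSff_of_frames hz h₁ h₂ contDiffOn_const contDiffOn_const contDiffOn_const, hv,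
      Prod.mk_eq_zero] at e
    have e1 := hn0 (h₂.norm z hz) e.2
    simpa [hne (hP.mem z hz).2 (h₂.norm z hz) (h₂.orth z hz)] using e1
  exact ⟨⟨_, _, h₁.inCurve hV (fun z hz => (hP.diff hz).fst) (fun z hz => (hP.mem z hz).1) hκ₁
      ⟨hu₁, hu₂⟩⟩,
    ⟨_, _, h₂.inCurve hV (fun z hz => (hP.diff hz).snd) (fun z hz => (hP.mem z hz).2) hκ₂
      ⟨hu₁, hu₂⟩⟩⟩

end IsPatch

/-! ### Uniqueness of the plane containing a curve -/

theorem InCurve.mink_fderiv {y : R2 → R31} {u : R2} {a : R31} {κ : ℝ} (h : InCurve y u a κ)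
    (hy : DifferentiableAt ℝ y u) (v : R2) : mink (fderiv ℝ y u v) a = 0 := by
  rw [mink_fderiv_of_eventually_eq (g := fun _ => a) hy (differentiableAt_const a) h.2]
  simp

theorem InCurve.eventually {y : R2 → R31} {u : R2} {a : R31} {κ : ℝ} (h : InCurve y u a κ) :
    ∀ᶠ z in 𝓝 u, InCurve y z a κ :=
  (eventually_eventually_nhds.2 h.2).mono fun _ hz => ⟨h.1, hz⟩

theorem InCurve.mink_eq {y : R2 → R31} {u : R2} {a : R31} {κ : ℝ} (h : InCurve y u a κ) :
    mink (y u) a = -κ := h.2.self_of_nhds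

/-- The unit normal of the curve `⟨y, a⟩ = -κ`. -/
theorem normal_of_curve {y a : R31} {κ : ℝ} (hy : y ∈ hyp (-1)) (ha : mink a a = 1 - κ ^ 2)
    (hya : mink y a = -κ) : mink (a - κ • y) (a - κ • y) = 1 ∧ mink (a - κ • y) y = 0 := by
  constructor
  · simp only [mink_sub_left, mink_sub_right, mink_smul_left, mink_smul_right,
      mink_self_of_mem hy, ha, mink_comm a y, hya]
    ring
  · simp only [mink_sub_left, mink_smul_left, mink_self_of_mem hy, mink_comm a y, hya]
    ring

/-- Both `a - κ y` and `a' - κ' y` are unit normals of the same curve, so they agree up to a sign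
`ε`. Pairing with the second derivative shows that the curvatures differ by the same sign. -/
theorem InCurve.unique {y : R2 → R31} {u : R2} {a a' : R31} {κ κ' : ℝ}
    (h : InCurve y u a κ) (h' : InCurve y u a' κ') (hs : ∀ᶠ z in 𝓝 u, ContDiffAt ℝ ∞ y z)
    (hm : ∀ᶠ z in 𝓝 u, y z ∈ hyp (-1)) {v : R2} (hv : fderiv ℝ y u v ≠ 0) :
    (a' = a ∧ κ' = κ) ∨ (a' = -a ∧ κ' = -κ) := by
  have hsu := hs.self_of_nhds
  have hmu := hm.self_of_nhds
  have hyd := differentiableAt_of_infty hsu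
  have hty : ∀ z, ContDiffAt ℝ ∞ y z → (∀ᶠ w in 𝓝 z, y w ∈ hyp (-1)) →
      mink (fderiv ℝ y z v) (y z) = 0 := fun z hz hmz =>
    mink_fderiv_self_of_eventually_eq (differentiableAt_of_infty hz)
      (hmz.mono fun w hw => mink_self_of_mem hw) v
  set D := fderiv ℝ (fun z => fderiv ℝ y z v) u v with hD
  have hDd : DifferentiableAt ℝ (fun z => fderiv ℝ y z v) u :=
    differentiableAt_of_infty (contDiffAt_fderiv_apply hsu contDiffAt_const)
  have hDy : mink D (y u) = -mink (fderiv ℝ y u v) (fderiv ℝ y u v) := by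
    refine mink_fderiv_of_eventually_eq (c := 0) hDd hyd ?_ v
    filter_upwards [hs, eventually_eventually_nhds.2 hm] with z h1 h2 using hty z h1 h2
  have hDa : ∀ {a κ}, InCurve y u a κ → mink D a = 0 := by
    intro a κ h
    have h1 := mink_fderiv_of_eventually_eq (c := 0) (g := fun _ => a) hDd
      (differentiableAt_const a) (by
        filter_upwards [hs, h.eventually] with z h1 h2
        exact h2.mink_fderiv (differentiableAt_of_infty h1) v) v
    rw [← hD] at h1
    rw [h1]
    simp
  obtain ⟨e1, e2⟩ := normal_of_curve hmu h.1 h.mink_eq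
  obtain ⟨e1', e2'⟩ := normal_of_curve hmu h'.1 h'.mink_eq
  have hg := mink_self_pos hmu (hty u hsu hm) hv
  have t : ∀ {a κ}, InCurve y u a κ → mink (a - κ • y u) (fderiv ℝ y u v) = 0 := by
    intro a κ h
    rw [mink_sub_left, mink_smul_left, mink_comm, h.mink_fderiv hyd, mink_comm (y u),
      hty u hsu hm]
    ring
  have hDn : ∀ {a κ}, InCurve y u a κ → mink D (a - κ • y u) =
      κ * mink (fderiv ℝ y u v) (fderiv ℝ y u v) := by
    intro a κ h
    rw [mink_sub_right, mink_smul_right, hDa h, hDy]; ring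
  -- The orthogonal complement of `y` and its nonzero derivative is a line, spanned by the normal.
  obtain ⟨ε, hε⟩ : ∃ ε : ℝ, a' - κ' • y u = ε • (a - κ • y u) := by
    have h1 := IsPatch.eq_smul_of_normal hmu e1 e2 (hty u hsu hm) (t h)
    have h2 := frame_expansion hmu e1 e2 (a' - κ' • y u)
    have h3 : mink (a' - κ' • y u) (lcross (a - κ • y u) (y u)) = 0 := by
      have h4 := t h'
      rw [h1, mink_smul_right] at h4
      refine (mul_eq_zero.1 h4).resolve_left fun h5 => hv ?_
      rw [h1, h5, zero_smul]
    rw [e2', h3] at h2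
    exact ⟨_, by simpa using h2⟩
  have hκ : κ' = ε * κ := by
    have h1 := hDn h'
    rw [hε, mink_smul_right, hDn h] at h1
    exact mul_right_cancel₀ hg.ne' (by linarith)
  have ha : a' = ε • a := by
    rw [hκ] at hε
    have : a' = ε • (a - κ • y u) + (ε * κ) • y u := by rw [← hε]; simp
    rw [this, smul_sub, smul_smul]; simp
  have hε2 : ε = 1 ∨ ε = -1 := by
    rw [hε, mink_smul_left, mink_smul_right, e1] at e1'
    exact mul_self_eq_one_iff.1 (by linarith)
  rcases hε2 with rfl | rfl
  · exact Or.inl ⟨by rw [ha, one_smul], by rw [hκ, one_mul]⟩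
  · exact Or.inr ⟨by rw [ha, neg_smul, one_smul], by rw [hκ, neg_one_mul]⟩

/-! ### Surfaces on which both factors induce the same metric -/

theorem basis_expansion (a b c w : R31) : mink (lcross a b) c • w =
    mink w (lcross b c) • a + mink w (lcross c a) • b + mink w (lcross a b) • c := by
  ext i
  fin_cases i <;> simp [mink, lcross] <;> ring

/-- The linear map taking the basis `a, b, c` to `a', b', c'`. -/
def changeBasis (a b c a' b' c' : R31) : R31 →L[ℝ] R31 :=
  (mink (lcross a b) c)⁻¹ • ((minkL (lcross b c)).smulRight a' + (minkL (lcross c a)).smulRight b' +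
    (minkL (lcross a b)).smulRight c')

theorem changeBasis_apply {a b c a' b' c' : R31} (h : mink (lcross a b) c ≠ 0) :
    changeBasis a b c a' b' c' a = a' ∧ changeBasis a b c a' b' c' b = b' ∧
      changeBasis a b c a' b' c' c = c' := by
  have h1 : mink (lcross b c) a = mink (lcross a b) c := by rw [← mink_lcross_rotate]
  have h2 : mink (lcross c a) b = mink (lcross a b) c := by rw [← h1, mink_lcross_rotate b c a]
  refine ⟨?_, ?_, ?_⟩ <;>
    simp [changeBasis, mink_lcross_self_left, mink_lcross_self_right, h1, h2, h]

theorem contDiffAt_changeBasis {a b c a' b' c' : R2 → R31} {u : R2} (ha : ContDiffAt ℝ ∞ a u)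
    (hb : ContDiffAt ℝ ∞ b u) (hc : ContDiffAt ℝ ∞ c u) (ha' : ContDiffAt ℝ ∞ a' u)
    (hb' : ContDiffAt ℝ ∞ b' u) (hc' : ContDiffAt ℝ ∞ c' u)
    (h : mink (lcross (a u) (b u)) (c u) ≠ 0) :
    ContDiffAt ℝ ∞ (fun z => changeBasis (a z) (b z) (c z) (a' z) (b' z) (c' z)) u := by
  have key : ∀ f g k : R2 → R31, ContDiffAt ℝ ∞ f u → ContDiffAt ℝ ∞ g u → ContDiffAt ℝ ∞ k u →
      ContDiffAt ℝ ∞ (fun z => (minkL (lcross (f z) (g z))).smulRight (k z)) u :=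
    fun f g k hf hg hk => ContDiffAt.smulRight
      ((minkL.contDiff.contDiffAt).comp u (contDiffAt_lcross hf hg)) hk
  exact ((contDiffAt_mink (contDiffAt_lcross ha hb) hc).inv h).smul
    (((key _ _ _ hb hc ha').add (key _ _ _ hc ha hb')).add (key _ _ _ ha hb hc'))

namespace IsPatch

variable {x : R2 → R62} {U : Set R2} {u : R2}

theorem fst_injective (h : IsPatch x U) (hu : u ∈ U)
    (hg : ∀ v w, mink (fderiv ℝ x u v).1 (fderiv ℝ x u w).1 =
      mink (fderiv ℝ x u v).2 (fderiv ℝ x u w).2) {v : R2} (hv : (fderiv ℝ x u v).1 = 0) :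
    v = 0 := by
  by_contra h0
  refine (h.ip_fderiv_self_pos hu h0).ne' ?_
  rw [ip, ← hg, hv]; simp

/-- If the first component had a kernel direction, equality of the metrics would make that direction
null for the induced metric. This separates the two cases of the dichotomy and makes `x₁`, `∂₀x₁`,
`∂₁x₁` a basis. -/
theorem area_ne_zero (h : IsPatch x U) (hu : u ∈ U)
    (hg : ∀ v w, mink (fderiv ℝ x u v).1 (fderiv ℝ x u w).1 =
      mink (fderiv ℝ x u v).2 (fderiv ℝ x u w).2) :
    mink (lcross (x u).1 (fderiv ℝ x u (EuclideanSpace.single 0 1)).1)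
      (fderiv ℝ x u (EuclideanSpace.single 1 1)).1 ≠ 0 := by
  intro h0
  obtain ⟨v, hv, hv0⟩ := exists_ne_zero_map_eq_zero (h.mem u hu).1
    (LinearMap.fst ℝ R31 R31 ∘ₗ (fderiv ℝ x u).toLinearMap) (fun v => (h.fderiv_mem hu v).1)
    (fun v w => by
      have e := mink_lcross_self_right (x u).1
      have e' := mink_lcross_swap (x u).1 (fderiv ℝ x u (EuclideanSpace.single 1 1)).1
        (fderiv ℝ x u (EuclideanSpace.single 0 1)).1
      rw [h0] at e'
      have hlin : ∀ v : R2, lcross (x u).1 (fderiv ℝ x u v).1 =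
          v 0 • lcross (x u).1 (fderiv ℝ x u (EuclideanSpace.single 0 1)).1 +
          v 1 • lcross (x u).1 (fderiv ℝ x u (EuclideanSpace.single 1 1)).1 := fun v => by
        rw [fderiv_eq_sum_coordTangent x u v]
        simp only [Fin.sum_univ_two, coordTangent, Prod.fst_add, Prod.smul_fst, ← lcrossL_apply,
          map_add, map_smul]
      simp only [LinearMap.comp_apply, LinearMap.fst_apply, ContinuousLinearMap.coe_coe]
      rw [hlin, fderiv_eq_sum_coordTangent x u w]
      simp only [Fin.sum_univ_two, coordTangent, Prod.fst_add, Prod.smul_fst, mink_add_left,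
        mink_add_right, mink_smul_left, mink_smul_right, e, e', h0]
      ring)
  exact hv (h.fst_injective hu hg hv0)

theorem exists_eq_smul_add (h : IsPatch x U) (hu : u ∈ U)
    (hg : ∀ v w, mink (fderiv ℝ x u v).1 (fderiv ℝ x u w).1 =
      mink (fderiv ℝ x u v).2 (fderiv ℝ x u w).2) (w : R31) :
    ∃ (α : ℝ) (v : R2), w = α • (x u).1 + (fderiv ℝ x u v).1 := by
  have h1 := h.area_ne_zero hu hg
  obtain ⟨a, b, c, h2⟩ : ∃ a b c : ℝ,
      mink (lcross (x u).1 (fderiv ℝ x u (EuclideanSpace.single 0 1)).1)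
        (fderiv ℝ x u (EuclideanSpace.single 1 1)).1 • w =
      a • (x u).1 + b • (fderiv ℝ x u (EuclideanSpace.single 0 1)).1 +
        c • (fderiv ℝ x u (EuclideanSpace.single 1 1)).1 := ⟨_, _, _, basis_expansion _ _ _ w⟩
  generalize mink (lcross (x u).1 (fderiv ℝ x u (EuclideanSpace.single 0 1)).1)
      (fderiv ℝ x u (EuclideanSpace.single 1 1)).1 = D at h1 h2
  refine ⟨D⁻¹ * a, D⁻¹ • (b • EuclideanSpace.single 0 1 + c • EuclideanSpace.single 1 1), ?_⟩
  rw [map_smul, map_add, map_smul, map_smul, Prod.smul_fst, Prod.fst_add, Prod.smul_fst,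
    Prod.smul_fst, mul_smul, ← smul_add, ← add_assoc, ← h2, smul_smul, inv_mul_cancel₀ h1, one_smul]

/-- `A` intertwines the two factors of the surface to first order at `u`. -/
def Intertwines (x : R2 → R62) (u : R2) (A : R31 →L[ℝ] R31) : Prop :=
  A (x u).1 = (x u).2 ∧ ∀ v, A (fderiv ℝ x u v).1 = (fderiv ℝ x u v).2

theorem Intertwines.mink_map (h : IsPatch x U) (hu : u ∈ U)
    (hg : ∀ v w, mink (fderiv ℝ x u v).1 (fderiv ℝ x u w).1 =
      mink (fderiv ℝ x u v).2 (fderiv ℝ x u w).2) {A : R31 →L[ℝ] R31} (hA : Intertwines x u A)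
    (a b : R31) : mink (A a) (A b) = mink a b := by
  obtain ⟨α, v, rfl⟩ := h.exists_eq_smul_add hu hg a
  obtain ⟨β, w, rfl⟩ := h.exists_eq_smul_add hu hg b
  simp only [map_add, map_smul, hA.1, hA.2, mink_add_left, mink_add_right, mink_smul_left,
    mink_smul_right, mink_self_of_mem (h.mem u hu).1, mink_self_of_mem (h.mem u hu).2,
    mink_comm (x u).1, mink_comm (x u).2, (h.fderiv_mem hu _).1, (h.fderiv_mem hu _).2, hg]

theorem Intertwines.unique (h : IsPatch x U) (hu : u ∈ U)
    (hg : ∀ v w, mink (fderiv ℝ x u v).1 (fderiv ℝ x u w).1 =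
      mink (fderiv ℝ x u v).2 (fderiv ℝ x u w).2) {A B : R31 →L[ℝ] R31}
    (hA : Intertwines x u A) (hB : Intertwines x u B) : A = B := by
  ext1 a
  obtain ⟨α, v, rfl⟩ := h.exists_eq_smul_add hu hg a
  simp only [map_add, map_smul, hA.1, hA.2, hB.1, hB.2]

/-- The intertwining map `A z` is determined by a basis moving with `z`. It preserves the metric,
and its derivative vanishes, so it is locally constant. -/
theorem exists_intertwines (h : IsPatch x U)
    (hg : ∀ u ∈ U, ∀ v w, mink (fderiv ℝ x u v).1 (fderiv ℝ x u w).1 =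
      mink (fderiv ℝ x u v).2 (fderiv ℝ x u w).2) (hu : u ∈ U) :
    ∃ A, ∀ᶠ z in 𝓝 u, Intertwines x z A := by
  set e₀ : R2 := EuclideanSpace.single 0 1
  set e₁ : R2 := EuclideanSpace.single 1 1
  set A : R2 → R31 →L[ℝ] R31 := fun z => changeBasis (x z).1 (fderiv ℝ x z e₀).1
    (fderiv ℝ x z e₁).1 (x z).2 (fderiv ℝ x z e₀).2 (fderiv ℝ x z e₁).2 with hA
  have hint : ∀ z ∈ U, Intertwines x z (A z) := by
    intro z hz
    obtain ⟨h0, h1, h2⟩ := changeBasis_apply (a' := (x z).2) (b' := (fderiv ℝ x z e₀).2)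
      (c' := (fderiv ℝ x z e₁).2) (h.area_ne_zero hz (hg z hz))
    refine ⟨h0, fun v => ?_⟩
    rw [fderiv_eq_sum_coordTangent x z v]
    simp only [Fin.sum_univ_two, coordTangent, Prod.fst_add, Prod.smul_fst, map_add, map_smul,
      Prod.snd_add, Prod.smul_snd]
    change v 0 • A z (fderiv ℝ x z e₀).1 + v 1 • A z (fderiv ℝ x z e₁).1 =
      v 0 • (fderiv ℝ x z e₀).2 + v 1 • (fderiv ℝ x z e₁).2
    rw [show A z (fderiv ℝ x z e₀).1 = _ from h1, show A z (fderiv ℝ x z e₁).1 = _ from h2]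
  have hAs : ∀ z ∈ U, ContDiffAt ℝ ∞ A z := by
    intro z hz
    have hx := h.smooth z hz
    have hd : ∀ e : R2, ContDiffAt ℝ ∞ (fun y => fderiv ℝ x y e) z := fun e =>
      contDiffAt_fderiv_apply hx contDiffAt_const
    exact contDiffAt_changeBasis hx.fst (hd _).fst (hd _).fst hx.snd (hd _).snd (hd _).snd
      (h.area_ne_zero hz (hg z hz))
  have hA0 : ∀ z ∈ U, fderiv ℝ A z = 0 := by
    intro z hz
    have hx := h.smooth z hz
    have hAd := differentiableAt_of_infty (hAs z hz)
    have hD : ∀ e : R2, DifferentiableAt ℝ (fun y => fderiv ℝ x y e) z := fun e =>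
      differentiableAt_of_infty (contDiffAt_fderiv_apply hx contDiffAt_const)
    -- Product rule for `A y (f y).1 = (f y).2`; it is applied to `x` and to its coordinate
    -- derivatives.
    have key : ∀ f : R2 → R62, DifferentiableAt ℝ f z → (∀ y ∈ U, A y (f y).1 = (f y).2) →
        ∀ w, fderiv ℝ A z w (f z).1 = (fderiv ℝ f z w).2 - A z (fderiv ℝ f z w).1 := by
      intro f hf hAf w
      have e1 : (fun y => A y (f y).1) =ᶠ[𝓝 z] fun y => (f y).2 :=
        (h.eventually hz).mono hAf
      have e2 := congrArg (fun T : R2 →L[ℝ] R31 => T w) e1.fderiv_eq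
      simp only [fderiv_snd_apply hf] at e2
      rw [fderiv_clm_apply hAd hf.fst] at e2
      simp only [add_apply, ContinuousLinearMap.comp_apply, fderiv_fst_apply hf,
        ContinuousLinearMap.flip_apply] at e2
      rw [← e2]; abel
    have k0 : ∀ w, fderiv ℝ A z w (x z).1 = 0 := fun w => by
      rw [key x (h.diff hz) (fun y hy => (hint y hy).1), (hint z hz).2, sub_self]
    have k1 : ∀ w v, fderiv ℝ A z w (fderiv ℝ x z v).1 =
        fderiv ℝ A z v (fderiv ℝ x z w).1 := fun w v => by
      rw [key _ (hD v) (fun y hy => (hint y hy).2 v), key _ (hD w) (fun y hy => (hint y hy).2 w),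
        fderiv_fderiv_apply hx (differentiableAt_const v),
        fderiv_fderiv_apply hx (differentiableAt_const w), fderiv_fderiv_symm hx]
      simp
    -- Differentiate `⟨A a, A b⟩ = ⟨a, b⟩`.
    have skew : ∀ w a b, mink (fderiv ℝ A z w a) (A z b) =
        -mink (fderiv ℝ A z w b) (A z a) := by
      intro w a b
      have dA : ∀ a, DifferentiableAt ℝ (fun y => A y a) z := fun a =>
        hAd.clm_apply (differentiableAt_const a)
      have fA : ∀ a, fderiv ℝ (fun y => A y a) z w = fderiv ℝ A z w a := fun a => by
        rw [fderiv_clm_apply hAd (differentiableAt_const a)]; simp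
      have e := mink_fderiv_of_eventually_eq (dA a) (dA b)
        ((h.eventually hz).mono fun y hy => (hint y hy).mink_map h hy (hg y hy) a b) w
      rw [fA, fA, mink_comm (A z a)] at e
      exact e
    have k2 : ∀ w v, fderiv ℝ A z w (fderiv ℝ x z v).1 = 0 := by
      intro w v
      -- The trilinear form `⟨dA(w) dx₁(v), A dx₁(t)⟩` is symmetric in `w, v` by `k1` and skew in
      -- `v, t` by `skew`, hence zero.
      have T : ∀ t, mink (fderiv ℝ A z w (fderiv ℝ x z v).1)
          (A z (fderiv ℝ x z t).1) = 0 := by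
        intro t
        have e1 := skew w (fderiv ℝ x z v).1 (fderiv ℝ x z t).1
        have e2 := skew t (fderiv ℝ x z w).1 (fderiv ℝ x z v).1
        have e3 := skew v (fderiv ℝ x z t).1 (fderiv ℝ x z w).1
        rw [k1 w t] at e1
        rw [k1 t v] at e2
        rw [k1 v w] at e3
        linarith
      have T0 := skew w (fderiv ℝ x z v).1 (x z).1
      rw [k0, mink_zero_left, neg_zero] at T0
      have hsurj : ∀ a, mink (fderiv ℝ A z w (fderiv ℝ x z v).1) (A z a) = 0 := by
        intro a
        obtain ⟨α, t, rfl⟩ := h.exists_eq_smul_add hz (hg z hz) a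
        rw [map_add, map_smul, mink_add_right, mink_smul_right, T0, T]; ring
      have hinj : Function.Injective (A z).toLinearMap := by
        rw [injective_iff_map_eq_zero]
        intro a ha
        refine eq_of_mink_eq fun c => ?_
        rw [← (hint z hz).mink_map h hz (hg z hz), show A z a = 0 from ha]
        simp
      refine eq_of_mink_eq fun c => ?_
      obtain ⟨a, rfl⟩ := LinearMap.surjective_of_injective hinj c
      rw [mink_zero_left]
      exact hsurj a
    ext1 w
    ext1 a
    obtain ⟨α, t, rfl⟩ := h.exists_eq_smul_add hz (hg z hz) a
    rw [map_add, map_smul, k0, k2]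
    simp
  have hconst := eventually_eq_of_fderiv_eq_zero (f := A) (u₀ := u)
    ((h.eventually hu).mono fun z hz => ⟨differentiableAt_of_infty (hAs z hz), hA0 z hz⟩)
  refine ⟨A u, ?_⟩
  filter_upwards [hconst, h.eventually hu] with z h1 h2
  rw [← h1]
  exact hint z h2

end IsPatch

/-! ### From charts to the surface -/

/-- Local solutions of a rigid relation on a connected space patch together. -/
theorem exists_forall_of_rigid {S T : Type*} [TopologicalSpace S] [ConnectedSpace S]
    (R : S → T → Prop) (hex : ∀ p, ∃ t, ∀ᶠ q in 𝓝 p, R q t)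
    (huniq : ∀ p t t', R p t → R p t' → ∀ q, R q t → R q t') : ∃ t, ∀ p, R p t := by
  obtain ⟨p₀⟩ := (inferInstance : Nonempty S)
  obtain ⟨t₀, ht₀⟩ := hex p₀
  refine ⟨t₀, ?_⟩
  have hopen : IsOpen {q | R q t₀} := by
    rw [isOpen_iff_mem_nhds]
    intro q hq
    obtain ⟨t, ht⟩ := hex q
    exact ht.mono fun q' hq' => huniq q t t₀ ht.self_of_nhds hq q' hq'
  have hclosed : IsClosed {q | R q t₀} := by
    rw [← isOpen_compl_iff, isOpen_iff_mem_nhds]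
    intro q hq
    obtain ⟨t, ht⟩ := hex q
    exact ht.mono fun q' hq' h => hq (huniq q' t t₀ hq' h q ht.self_of_nhds)
  have h := (IsClopen.eq_univ ⟨hclosed, hopen⟩ ⟨p₀, ht₀.self_of_nhds⟩)
  exact fun p => (h.ge (mem_univ p) : _)

section Charts

variable {S : Type*} [TopologicalSpace S]

theorem eventually_of_chart (e : OpenPartialHomeomorph S R2) {p : S} (hp : p ∈ e.source)
    {P : S → Prop} (h : ∀ᶠ u in 𝓝 (e p), P (e.symm u)) : ∀ᶠ q in 𝓝 p, P q := by
  filter_upwards [(e.continuousAt hp).eventually h, e.open_source.mem_nhds hp] with q hq hqs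
  rwa [e.left_inv hqs] at hq

theorem eventually_chart (e : OpenPartialHomeomorph S R2) {u : R2} (hu : u ∈ e.target)
    {P : S → Prop} (h : ∀ᶠ q in 𝓝 (e.symm u), P q) : ∀ᶠ z in 𝓝 u, P (e.symm z) :=
  (e.continuousAt_symm hu).eventually h

variable [ChartedSpace R2 S] {Φ : S → R62} {e : OpenPartialHomeomorph S R2}

theorem mdifferentiable_of_mem_maximalAtlas (he : e ∈ IsManifold.maximalAtlas (𝓡 2) ∞ S) :
    e.MDifferentiable (𝓡 2) (𝓡 2) :=
  ⟨(contMDiffOn_of_mem_maximalAtlas he).mdifferentiableOn (by simp),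
    (contMDiffOn_symm_of_mem_maximalAtlas he).mdifferentiableOn (by simp)⟩

theorem nablaSff_const_eq_zero (hpar : HasParallelSff Φ)
    (he : e ∈ IsManifold.maximalAtlas (𝓡 2) ∞ S) {u : R2} (hu : u ∈ e.target) (X Y Z : R2) :
    nablaSff (fun y => Φ (e.symm y)) (fun _ => X) (fun _ => Y) (fun _ => Z) u = 0 :=
  hpar e he _ _ _ contDiffOn_const contDiffOn_const contDiffOn_const u hu

variable [IsManifold (𝓡 2) ∞ S]

theorem fderiv_chart (hΦ : ContMDiff (𝓡 2) 𝓘(ℝ, R62) ∞ Φ)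
    (he : e ∈ IsManifold.maximalAtlas (𝓡 2) ∞ S) {u : R2} (hu : u ∈ e.target) :
    ∃ L : R2 ≃ₗ[ℝ] TangentSpace (𝓡 2) (e.symm u),
      ∀ v, fderiv ℝ (fun y => Φ (e.symm y)) u v = mfderiv (𝓡 2) 𝓘(ℝ, R62) Φ (e.symm u) (L v) := by
  have : IsManifold (𝓡 2) 1 S := IsManifold.of_le (n := ∞) (by simp)
  have hm := mdifferentiable_of_mem_maximalAtlas he
  refine ⟨(hm.symm.mfderiv hu).toLinearEquiv, fun v => ?_⟩
  rw [← mfderiv_eq_fderiv]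
  exact congrArg (fun T : R2 →L[ℝ] R62 => T v) (mfderiv_comp u
    (hΦ.mdifferentiableAt (by simp)) (hm.mdifferentiableAt_symm hu))

theorem isPatch_chart (hΦ : IsLagrangianImmersion Φ)
    (he : e ∈ IsManifold.maximalAtlas (𝓡 2) ∞ S) :
    IsPatch (fun y => Φ (e.symm y)) e.target where
  isOpen := e.open_target
  smooth u hu := by
    rw [← contMDiffAt_iff_contDiffAt]
    exact (hΦ.smooth (e.symm u)).comp u (contMDiffAt_symm_of_mem_maximalAtlas he hu)
  mem u _ := hΦ.mem _
  inj u hu := by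
    obtain ⟨L, hL⟩ := fderiv_chart hΦ.smooth he hu
    intro v w hvw
    rw [hL, hL] at hvw
    exact L.injective (hΦ.immersion _ hvw)

theorem omega_chart (hΦ : IsLagrangianImmersion Φ)
    (he : e ∈ IsManifold.maximalAtlas (𝓡 2) ∞ S) {u : R2} (hu : u ∈ e.target) (v w : R2) :
    omega (Φ (e.symm u)) (fderiv ℝ (fun y => Φ (e.symm y)) u v)
      (fderiv ℝ (fun y => Φ (e.symm y)) u w) = 0 := by
  obtain ⟨L, hL⟩ := fderiv_chart hΦ.smooth he hu
  rw [hL, hL]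
  exact hΦ.lagrangian _ _ _

/-- The first component of `Φ` has rank at most one at `p`. -/
def AreaZero (Φ : S → R62) (p : S) : Prop := ∀ v w : TangentSpace (𝓡 2) p,
  mink (lcross (Φ p).1 (mfderiv (𝓡 2) 𝓘(ℝ, R62) Φ p v : R62).1)
    (mfderiv (𝓡 2) 𝓘(ℝ, R62) Φ p w : R62).1 = 0

/-- Both components of `Φ` induce the same metric at `p`. -/
def SameMetric (Φ : S → R62) (p : S) : Prop := ∀ v w : TangentSpace (𝓡 2) p,
  mink (mfderiv (𝓡 2) 𝓘(ℝ, R62) Φ p v : R62).1 (mfderiv (𝓡 2) 𝓘(ℝ, R62) Φ p w : R62).1 =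
    mink (mfderiv (𝓡 2) 𝓘(ℝ, R62) Φ p v : R62).2 (mfderiv (𝓡 2) 𝓘(ℝ, R62) Φ p w : R62).2

/-- `A` maps the first component of `Φ` to the second one, to first order at `p`. -/
def IntertwinesAt (Φ : S → R62) (p : S) (A : R31 →L[ℝ] R31) : Prop :=
  A (Φ p).1 = (Φ p).2 ∧ ∀ v : TangentSpace (𝓡 2) p,
    A (mfderiv (𝓡 2) 𝓘(ℝ, R62) Φ p v : R62).1 = (mfderiv (𝓡 2) 𝓘(ℝ, R62) Φ p v : R62).2

theorem areaZero_chart (hΦ : ContMDiff (𝓡 2) 𝓘(ℝ, R62) ∞ Φ)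
    (he : e ∈ IsManifold.maximalAtlas (𝓡 2) ∞ S) {u : R2} (hu : u ∈ e.target) :
    AreaZero Φ (e.symm u) ↔ ∀ v w, mink (lcross (Φ (e.symm u)).1
      (fderiv ℝ (fun y => Φ (e.symm y)) u v).1) (fderiv ℝ (fun y => Φ (e.symm y)) u w).1 = 0 := by
  obtain ⟨L, hL⟩ := fderiv_chart hΦ he hu
  simp only [hL, AreaZero, L.surjective.forall]

theorem sameMetric_chart (hΦ : ContMDiff (𝓡 2) 𝓘(ℝ, R62) ∞ Φ)
    (he : e ∈ IsManifold.maximalAtlas (𝓡 2) ∞ S) {u : R2} (hu : u ∈ e.target) :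
    SameMetric Φ (e.symm u) ↔ ∀ v w, mink (fderiv ℝ (fun y => Φ (e.symm y)) u v).1
      (fderiv ℝ (fun y => Φ (e.symm y)) u w).1 = mink (fderiv ℝ (fun y => Φ (e.symm y)) u v).2
      (fderiv ℝ (fun y => Φ (e.symm y)) u w).2 := by
  obtain ⟨L, hL⟩ := fderiv_chart hΦ he hu
  simp only [hL, SameMetric, L.surjective.forall]

theorem intertwinesAt_chart (hΦ : ContMDiff (𝓡 2) 𝓘(ℝ, R62) ∞ Φ)
    (he : e ∈ IsManifold.maximalAtlas (𝓡 2) ∞ S) {u : R2} (hu : u ∈ e.target)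
    (A : R31 →L[ℝ] R31) : IntertwinesAt Φ (e.symm u) A ↔
      IsPatch.Intertwines (fun y => Φ (e.symm y)) u A := by
  obtain ⟨L, hL⟩ := fderiv_chart hΦ he hu
  simp only [hL, IntertwinesAt, IsPatch.Intertwines, L.surjective.forall]

theorem chart_facts (p : S) : chartAt R2 p ∈ IsManifold.maximalAtlas (𝓡 2) ∞ S ∧
    p ∈ (chartAt R2 p).source ∧ chartAt R2 p p ∈ (chartAt R2 p).target ∧
      (chartAt R2 p).symm (chartAt R2 p p) = p :=
  ⟨IsManifold.chart_mem_maximalAtlas p, mem_chart_source _ p, mem_chart_target _ p,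
    (chartAt R2 p).left_inv (mem_chart_source _ p)⟩

theorem isClosed_areaZero (hΦ : IsLagrangianImmersion Φ) : IsClosed {p | AreaZero Φ p} := by
  rw [← isOpen_compl_iff, isOpen_iff_mem_nhds]
  intro p hp
  obtain ⟨he, hps, hpt, hpe⟩ := chart_facts p
  set e := chartAt R2 p
  have hP := isPatch_chart hΦ he
  change ¬ AreaZero Φ p at hp
  rw [← hpe, areaZero_chart hΦ.smooth he hpt] at hp
  push Not at hp
  obtain ⟨v, w, hvw⟩ := hp
  refine eventually_of_chart e hps ?_
  have hx := hP.smooth _ hpt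
  have hd : ∀ v, ContDiffAt ℝ ∞ (fun z => fderiv ℝ (fun y => Φ (e.symm y)) z v) (e p) :=
    fun v => contDiffAt_fderiv_apply hx contDiffAt_const
  filter_upwards [(contDiffAt_mink (contDiffAt_lcross hx.fst (hd v).fst)
    (hd w).fst).continuousAt.eventually_ne hvw, hP.eventually hpt] with z hz hzt
  rw [areaZero_chart hΦ.smooth he hzt]
  exact fun h => hz (h v w)

theorem isClosed_sameMetric (hΦ : IsLagrangianImmersion Φ) : IsClosed {p | SameMetric Φ p} := by
  rw [← isOpen_compl_iff, isOpen_iff_mem_nhds]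
  intro p hp
  obtain ⟨he, hps, hpt, hpe⟩ := chart_facts p
  set e := chartAt R2 p
  have hP := isPatch_chart hΦ he
  change ¬ SameMetric Φ p at hp
  rw [← hpe, sameMetric_chart hΦ.smooth he hpt] at hp
  push Not at hp
  obtain ⟨v, w, hvw⟩ := hp
  refine eventually_of_chart e hps ?_
  have hx := hP.smooth _ hpt
  have hd : ∀ v, ContDiffAt ℝ ∞ (fun z => fderiv ℝ (fun y => Φ (e.symm y)) z v) (e p) :=
    fun v => contDiffAt_fderiv_apply hx contDiffAt_const
  filter_upwards [((contDiffAt_mink (hd v).fst (hd w).fst).sub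
    (contDiffAt_mink (hd v).snd (hd w).snd)).continuousAt.eventually_ne (sub_ne_zero.2 hvw),
    hP.eventually hpt] with z hz hzt
  rw [sameMetric_chart hΦ.smooth he hzt]
  exact fun h => hz (sub_eq_zero.2 (h v w))

/-- The two closed sets cover the surface and are disjoint, so each is also open and connectedness
applies. -/
theorem areaZero_or_sameMetric [ConnectedSpace S] (hΦ : IsLagrangianImmersion Φ)
    (hpar : HasParallelSff Φ) : (∀ p, AreaZero Φ p) ∨ ∀ p, SameMetric Φ p := by
  have hcover : ∀ p, AreaZero Φ p ∨ SameMetric Φ p := by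
    intro p
    obtain ⟨he, hps, hpt, hpe⟩ := chart_facts p
    rw [← hpe, areaZero_chart hΦ.smooth he hpt, sameMetric_chart hΦ.smooth he hpt]
    exact (isPatch_chart hΦ he).dichotomy hpt (omega_chart hΦ he hpt)
      (nablaSff_const_eq_zero hpar he hpt)
  have hdisj : ∀ p, AreaZero Φ p → ¬ SameMetric Φ p := by
    intro p
    obtain ⟨he, hps, hpt, hpe⟩ := chart_facts p
    rw [← hpe, areaZero_chart hΦ.smooth he hpt, sameMetric_chart hΦ.smooth he hpt]
    exact fun h1 h2 => (isPatch_chart hΦ he).area_ne_zero hpt h2 (h1 _ _)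
  have hcompl : {p | AreaZero Φ p} = {p | SameMetric Φ p}ᶜ := by
    ext p
    exact ⟨hdisj p, fun h => (hcover p).resolve_right h⟩
  have hclopen : IsClopen {p | AreaZero Φ p} :=
    ⟨isClosed_areaZero hΦ, hcompl ▸ (isClosed_sameMetric hΦ).isOpen_compl⟩
  rcases isClopen_iff.1 hclopen with h | h
  · exact Or.inr fun p => (hcover p).resolve_left fun hp => (h.le hp : p ∈ (∅ : Set S))
  · exact Or.inl fun p => h.ge (mem_univ p)

/-- At a single point the intertwining map is already unique, so the local constants patch together.
-/
theorem exists_intertwinesAt [ConnectedSpace S] (hΦ : IsLagrangianImmersion Φ)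
    (hg : ∀ p, SameMetric Φ p) : ∃ A, ∀ p, IntertwinesAt Φ p A := by
  have hg' : ∀ {e : OpenPartialHomeomorph S R2}, e ∈ IsManifold.maximalAtlas (𝓡 2) ∞ S →
      ∀ u ∈ e.target, ∀ v w, mink (fderiv ℝ (fun y => Φ (e.symm y)) u v).1
      (fderiv ℝ (fun y => Φ (e.symm y)) u w).1 = mink (fderiv ℝ (fun y => Φ (e.symm y)) u v).2
      (fderiv ℝ (fun y => Φ (e.symm y)) u w).2 := fun he u hu =>
    (sameMetric_chart hΦ.smooth he hu).1 (hg _)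
  refine exists_forall_of_rigid _ (fun p => ?_) fun p A B hA hB q hq => ?_
  · obtain ⟨he, hps, hpt, -⟩ := chart_facts p
    have hP := isPatch_chart hΦ he
    obtain ⟨A, hA⟩ := hP.exists_intertwines (hg' he) hpt
    refine ⟨A, eventually_of_chart _ hps ?_⟩
    filter_upwards [hA, hP.eventually hpt] with z hz hzt
    exact (intertwinesAt_chart hΦ.smooth he hzt A).2 hz
  · obtain ⟨he, hps, hpt, hpe⟩ := chart_facts p
    rw [← hpe, intertwinesAt_chart hΦ.smooth he hpt] at hA hB
    rwa [← hA.unique (isPatch_chart hΦ he) hpt (hg' he _ hpt) hB]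

theorem exists_curves [ConnectedSpace S] (hΦ : IsLagrangianImmersion Φ)
    (hpar : HasParallelSff Φ) (hω : ∀ p, AreaZero Φ p) :
    (∃ a κ, mink a a = 1 - κ ^ 2 ∧ ∀ p, mink (Φ p).1 a = -κ) ∧
      ∃ a κ, mink a a = 1 - κ ^ 2 ∧ ∀ p, mink (Φ p).2 a = -κ := by
  have hω₁ : ∀ {e : OpenPartialHomeomorph S R2}, e ∈ IsManifold.maximalAtlas (𝓡 2) ∞ S →
      ∀ u ∈ e.target, ∀ v w, mink (lcross (Φ (e.symm u)).1
      (fderiv ℝ (fun y => Φ (e.symm y)) u v).1) (fderiv ℝ (fun y => Φ (e.symm y)) u w).1 = 0 :=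
    fun he u hu => (areaZero_chart hΦ.smooth he hu).1 (hω _)
  have hω₂ : ∀ {e : OpenPartialHomeomorph S R2}, e ∈ IsManifold.maximalAtlas (𝓡 2) ∞ S →
      ∀ u ∈ e.target, ∀ v w, mink (lcross (Φ (e.symm u)).2
      (fderiv ℝ (fun y => Φ (e.symm y)) u v).2) (fderiv ℝ (fun y => Φ (e.symm y)) u w).2 = 0 := by
    intro e he u hu v w
    have h1 := omega_chart hΦ he hu v w
    simp only [omega, ip, J, mink_neg_left, hω₁ he u hu] at h1
    linarith
  have glob : ∀ f : S → R31, (∀ p, ∃ a κ, InCurve (fun y => f ((chartAt R2 p).symm y))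
        (chartAt R2 p p) a κ) → (∀ p a κ a' κ',
        InCurve (fun y => f ((chartAt R2 p).symm y)) (chartAt R2 p p) a κ →
        InCurve (fun y => f ((chartAt R2 p).symm y)) (chartAt R2 p p) a' κ' →
        (a' = a ∧ κ' = κ) ∨ (a' = -a ∧ κ' = -κ)) →
      ∃ a κ, mink a a = 1 - κ ^ 2 ∧ ∀ p, mink (f p) a = -κ := by
    intro f hex huniq
    have hR : ∀ p a κ, InCurve (fun y => f ((chartAt R2 p).symm y)) (chartAt R2 p p) a κ ↔
        mink a a = 1 - κ ^ 2 ∧ ∀ᶠ q in 𝓝 p, mink (f q) a = -κ := by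
      intro p a κ
      obtain ⟨he, hps, hpt, hpe⟩ := chart_facts p
      refine and_congr_right fun _ => ⟨fun h => eventually_of_chart _ hps h, fun h => ?_⟩
      exact eventually_chart (P := fun q => mink (f q) a = -κ) _ hpt (by rwa [hpe])
    simp only [hR] at hex huniq
    -- The plane relation is imposed near `q`, not just at `q`, since only then is `(a, κ)`
    -- determined up to sign.
    obtain ⟨⟨a, κ⟩, h⟩ := exists_forall_of_rigid (S := S) (T := R31 × ℝ)
      (fun p t => mink t.1 t.1 = 1 - t.2 ^ 2 ∧ ∀ᶠ q in 𝓝 p, mink (f q) t.1 = -t.2)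
      (fun p => by
        obtain ⟨a, κ, h1, h2⟩ := hex p
        exact ⟨(a, κ), (eventually_eventually_nhds.2 h2).mono fun q hq => ⟨h1, hq⟩⟩)
      (fun p ⟨a, κ⟩ ⟨a', κ'⟩ h h' q hq => by
        refine ⟨h'.1, ?_⟩
        -- The sign ambiguity is harmless: `(a, κ)` and `(-a, -κ)` describe the same plane.
        rcases huniq p _ _ _ _ h h' with ⟨rfl, rfl⟩ | ⟨rfl, rfl⟩
        · exact hq.2
        · exact hq.2.mono fun z hz => by
            change mink (f z) (-a) = - -κ
            rw [mink_neg_right, show mink (f z) a = -κ from hz])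
    have ⟨p₀⟩ := (inferInstance : Nonempty S)
    exact ⟨a, κ, (h p₀).1, fun p => (h p).2.self_of_nhds⟩
  have hloc : ∀ p : S, _ := fun p =>
    let hf := chart_facts (S := S) p
    (isPatch_chart hΦ hf.1).exists_inCurve (hω₁ hf.1) (hω₂ hf.1)
      (fun u hu => nablaSff_const_eq_zero hpar hf.1 hu) hf.2.2.1
  constructor
  · refine glob (fun p => (Φ p).1) (fun p => (hloc p).1) fun p a κ a' κ' h h' => ?_
    obtain ⟨he, hps, hpt, hpe⟩ := chart_facts p
    have hP := isPatch_chart hΦ he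
    obtain ⟨v, hv⟩ := hP.exists_fst_ne_zero hpt (hω₂ he _ hpt)
    exact h.unique h' ((hP.eventually hpt).mono fun z hz => (hP.smooth z hz).fst)
      ((hP.eventually hpt).mono fun z hz => (hP.mem z hz).1) (v := v)
      (by rwa [fderiv_fst_apply (hP.diff hpt)])
  · refine glob (fun p => (Φ p).2) (fun p => (hloc p).2) fun p a κ a' κ' h h' => ?_
    obtain ⟨he, hps, hpt, hpe⟩ := chart_facts p
    have hP := isPatch_chart hΦ he
    obtain ⟨v, hv⟩ := hP.exists_snd_ne_zero hpt (hω₁ he _ hpt)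
    exact h.unique h' ((hP.eventually hpt).mono fun z hz => (hP.smooth z hz).snd)
      ((hP.eventually hpt).mono fun z hz => (hP.mem z hz).2) (v := v)
      (by rwa [fderiv_snd_apply (hP.diff hpt)])

end Charts

/-! ### Curves of constant curvature in the hyperbolic plane -/

theorem hasDerivAt_mink {f g : ℝ → R31} {f' g' : R31} {s : ℝ} (hf : HasDerivAt f f' s)
    (hg : HasDerivAt g g' s) :
    HasDerivAt (fun r => mink (f r) (g r)) (mink f' (g s) + mink (f s) g') s := by
  have h := (minkL.hasFDerivAt_of_bilinear hf.hasFDerivAt hg.hasFDerivAt).hasDerivAt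
  simpa [add_comm] using h

theorem hasDerivAt_lcross {f g : ℝ → R31} {f' g' : R31} {s : ℝ} (hf : HasDerivAt f f' s)
    (hg : HasDerivAt g g' s) :
    HasDerivAt (fun r => lcross (f r) (g r)) (lcross f' (g s) + lcross (f s) g') s := by
  have h := (lcrossL.hasFDerivAt_of_bilinear hf.hasFDerivAt hg.hasFDerivAt).hasDerivAt
  simpa [add_comm] using h

theorem lcross_self (a : R31) : lcross a a = 0 := by
  ext i; fin_cases i <;> simp [lcross] <;> ring

/-- A curve of constant curvature `κ` in `ℍ²` lies in a plane section `⟨x, a⟩ = -κ`. -/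
theorem IsUnitSpeedCurve.exists_mink_eq {I : Set ℝ} {β : ℝ → R31} (h : IsUnitSpeedCurve I β)
    {κ : ℝ} (hκ : ∀ s ∈ I, geodesicCurvature β s = κ) {s₀ : ℝ} (hs₀ : s₀ ∈ I) :
    ∃ a, mink a a = 1 - κ ^ 2 ∧ ∀ s ∈ I, mink (β s) a = -κ := by
  have hβ : ∀ s ∈ I, ContDiffAt ℝ ∞ β s := fun s hs => h.smooth.contDiffAt (h.isOpen.mem_nhds hs)
  have d0 : ∀ s ∈ I, HasDerivAt β (deriv β s) s := fun s hs =>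
    (differentiableAt_of_infty (hβ s hs)).hasDerivAt
  have d1 : ∀ s ∈ I, HasDerivAt (deriv β) (deriv (deriv β) s) s := fun s hs =>
    (differentiableAt_of_infty ((contDiffAt_fderiv_apply (hβ s hs)
      (contDiffAt_const (c := (1 : ℝ)))))).hasDerivAt
  have near : ∀ s ∈ I, ∀ᶠ r in 𝓝 s, r ∈ I := fun s hs => h.isOpen.mem_nhds hs
  have const : ∀ {f g : ℝ → R31} {f' g' : R31} {s c : ℝ}, HasDerivAt f f' s → HasDerivAt g g' s →
      (∀ᶠ r in 𝓝 s, mink (f r) (g r) = c) → mink f' (g s) + mink (f s) g' = 0 := by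
    intro f g f' g' s c hf hg hc
    exact (hasDerivAt_mink hf hg).unique ((hasDerivAt_const s c).congr_of_eventuallyEq hc)
  have o1 : ∀ s ∈ I, mink (deriv β s) (β s) = 0 := fun s hs => by
    have := const (d0 s hs) (d0 s hs) ((near s hs).mono fun r hr => mink_self_of_mem (h.mem r hr))
    rw [mink_comm (β s)] at this; linarith
  have o2 : ∀ s ∈ I, mink (deriv (deriv β) s) (deriv β s) = 0 := fun s hs => by
    have := const (d1 s hs) (d1 s hs) ((near s hs).mono fun r hr => h.unit_speed r hr)
    rw [mink_comm (deriv β s)] at this; linarith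
  -- The equation `n' = -κ β'` for the normal `n = β ⊠ β'`, checked on the frame `β`, `β'`, `n`.
  -- Hence `n + κ β` is the constant vector sought.
  have key : ∀ s ∈ I, lcross (β s) (deriv (deriv β) s) + κ • deriv β s = 0 := by
    intro s hs
    refine eq_zero_of_mink_eq_zero (a := β s) (b := deriv β s) (c := lcross (β s) (deriv β s))
      ?_ ?_ ?_ ?_
    · rw [mink_lcross_self_of_mem (h.mem s hs) (o1 s hs), h.unit_speed s hs]; exact one_ne_zero
    · rw [mink_add_left, mink_smul_left, mink_lcross_self_left, o1 s hs]; ring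
    · have := hκ s hs
      rw [geodesicCurvature, mink_comm] at this
      rw [mink_add_left, mink_smul_left, mink_lcross_swap, this, h.unit_speed s hs]; ring
    · rw [mink_add_left, mink_smul_left, mink_lcross_lcross, mink_comm (β s) (deriv β s), o1 s hs,
        o2 s hs, mink_comm (deriv β s), mink_lcross_self_right]; ring
  have dA : ∀ s ∈ I, HasDerivAt (fun r => lcross (β r) (deriv β r) + κ • β r) 0 s := by
    intro s hs
    have := (hasDerivAt_lcross (d0 s hs) (d1 s hs)).add ((d0 s hs).const_smul κ)
    rw [lcross_self, zero_add, key s hs] at this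
    exact this
  refine ⟨lcross (β s₀) (deriv β s₀) + κ • β s₀, ?_, fun s hs => ?_⟩
  · simp only [mink_add_left, mink_add_right, mink_smul_left, mink_smul_right,
      mink_lcross_self_of_mem (h.mem s₀ hs₀) (o1 s₀ hs₀), h.unit_speed s₀ hs₀,
      mink_lcross_self_left, mink_comm (β s₀) (lcross _ _), mink_self_of_mem (h.mem s₀ hs₀)]
    ring
  · rw [← h.isOpen.is_const_of_deriv_eq_zero h.ordConnected.isPreconnected
      (fun r hr => (dA r hr).differentiableAt.differentiableWithinAt)
      (fun r hr => (dA r hr).deriv) hs hs₀]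
    simp only [mink_add_right, mink_smul_right, mink_comm (β s) (lcross _ _),
      mink_lcross_self_left, mink_self_of_mem (h.mem s hs)]
    ring

/-- The orbit of `x` under the one-parameter group of isometries generated by `v ↦ a ⊠ v`. -/
def orbit (a x : R31) (s : ℝ) : R31 := NormedSpace.exp (s • lcrossL a) x

theorem orbit_zero (a x : R31) : orbit a x 0 = x := by simp [orbit]

theorem orbit_add (a x : R31) (s t : ℝ) : orbit a x (s + t) = orbit a (orbit a x t) s := by
  let _ : NormedAlgebra ℚ (R31 →L[ℝ] R31) := NormedAlgebra.restrictScalars ℚ ℝ _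
  simp only [orbit]
  rw [add_smul, NormedSpace.exp_add_of_commute
    (((Commute.refl (lcrossL a)).smul_left s).smul_right t)]
  rfl

theorem hasDerivAt_orbit (a x : R31) (s : ℝ) :
    HasDerivAt (orbit a x) (lcross a (orbit a x s)) s := by
  have h := (hasDerivAt_exp_smul_const' (lcrossL a) s).clm_apply (hasDerivAt_const s x)
  rw [map_zero, add_zero] at h
  exact h

theorem contDiff_orbit (a x : R31) : ContDiff ℝ ∞ (orbit a x) := by
  rw [contDiff_iff_contDiffAt]
  intro s
  have h1 : ContDiffAt ℝ ∞ (fun s : ℝ => s • lcrossL a) s := contDiffAt_id.smul contDiffAt_const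
  have h2 : ContDiffAt ℝ ∞ (NormedSpace.exp : (R31 →L[ℝ] R31) → _) (s • lcrossL a) :=
    (NormedSpace.exp_analytic (𝕂 := ℝ) _).contDiffAt
  exact (h2.comp s h1).clm_apply contDiffAt_const

/-! ### Plane sections of the hyperbolic plane as orbits -/

section Orbits

variable {a x : R31} {κ : ℝ}

theorem mink_orbit_right (a x : R31) (s : ℝ) : mink (orbit a x s) a = mink x a := by
  have h : ∀ s, HasDerivAt (fun r => mink (orbit a x r) a) 0 s := fun s => by
    simpa [mink_lcross_self_left] using
      hasDerivAt_mink (hasDerivAt_orbit a x s) (hasDerivAt_const s a)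
  have := is_const_of_deriv_eq_zero (fun r => (h r).differentiableAt) (fun r => (h r).deriv) s 0
  simpa only [orbit_zero] using this

theorem mink_orbit_self (a x : R31) (s : ℝ) : mink (orbit a x s) (orbit a x s) = mink x x := by
  have h : ∀ s, HasDerivAt (fun r => mink (orbit a x r) (orbit a x r)) 0 s := fun s => by
    simpa [mink_lcross_self_right, mink_comm (orbit a x s)] using
      hasDerivAt_mink (hasDerivAt_orbit a x s) (hasDerivAt_orbit a x s)
  have := is_const_of_deriv_eq_zero (fun r => (h r).differentiableAt) (fun r => (h r).deriv) s 0
  simpa only [orbit_zero] using this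

theorem orbit_mem (hx : x ∈ hyp (-1)) (s : ℝ) : orbit a x s ∈ hyp (-1) := by
  obtain ⟨hx1, hx0⟩ := mem_hyp_iff.1 hx
  refine mem_hyp_iff.2 ⟨by rw [mink_orbit_self, hx1], ?_⟩
  by_contra! hneg
  have hc : Continuous fun s => orbit a x s 0 :=
    (continuous_apply 0).comp (contDiff_orbit a x).continuous
  -- To leave the upper sheet the orbit would have to cross `x 0 = 0`, where `⟨x,x⟩ ≥ 0`.
  obtain ⟨r, hr⟩ := mem_range_of_exists_le_of_exists_ge hc ⟨s, hneg⟩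
    ⟨0, by rw [orbit_zero]; exact hx0.le⟩
  have h1 := mink_orbit_self a x r
  rw [hx1] at h1
  simp only [mink] at h1
  simp only at hr
  nlinarith [sq_nonneg (orbit a x r 1), sq_nonneg (orbit a x r 2)]

/-- The curve of `ℍ²` in the plane `⟨x, a⟩ = -κ`. -/
def planeSection (a : R31) (κ : ℝ) : Set R31 := {x | x ∈ hyp (-1) ∧ mink x a = -κ}

theorem orbit_mem_planeSection (hx : x ∈ planeSection a κ) (s : ℝ) :
    orbit a x s ∈ planeSection a κ :=
  ⟨orbit_mem hx.1 s, by rw [mink_orbit_right, hx.2]⟩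

theorem mink_lcross_self_of_planeSection (ha : mink a a = 1 - κ ^ 2) (hx : x ∈ planeSection a κ) :
    mink (lcross a x) (lcross a x) = 1 := by
  rw [mink_lcross_lcross, ha, mink_self_of_mem hx.1, mink_comm a, hx.2]; ring

theorem deriv_orbit (a x : R31) : deriv (orbit a x) = fun s => lcross a (orbit a x s) :=
  funext fun s => (hasDerivAt_orbit a x s).deriv

theorem isUnitSpeedCurve_orbit (ha : mink a a = 1 - κ ^ 2) (hx : x ∈ planeSection a κ) :
    IsUnitSpeedCurve univ (orbit a x) where
  isOpen := isOpen_univ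
  ordConnected := ordConnected_univ
  smooth := (contDiff_orbit a x).contDiffOn
  mem s _ := orbit_mem hx.1 s
  unit_speed s _ := by
    rw [deriv_orbit]
    exact mink_lcross_self_of_planeSection ha (orbit_mem_planeSection hx s)

theorem hasConstantGeodesicCurvature_orbit (ha : mink a a = 1 - κ ^ 2)
    (hx : x ∈ planeSection a κ) : HasConstantGeodesicCurvature univ (orbit a x) := by
  refine ⟨κ, fun s _ => ?_⟩
  have h1 : deriv (fun s => lcross a (orbit a x s)) s = lcross a (lcross a (orbit a x s)) := by
    have h := hasDerivAt_lcross (hasDerivAt_const s a) (hasDerivAt_orbit a x s)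
    have h0 : lcross 0 (orbit a x s) = 0 := by simp [← lcrossL_apply]
    rw [h0, zero_add] at h
    exact h.deriv
  have hs := orbit_mem_planeSection hx s
  rw [geodesicCurvature, deriv_orbit, h1, mink_lcross_lcross,
    mink_lcross_self_of_planeSection ha hs, mink_comm a (lcross _ _), mink_lcross_self_left,
    mink_comm a, hs.2]
  ring

/-- Near a point, the curve `⟨x, a⟩ = -κ` is parametrized by the component along its tangent. -/
theorem exists_nhds_injOn (ha : mink a a = 1 - κ ^ 2) (hx : x ∈ planeSection a κ) :
    ∃ W, IsOpen W ∧ x ∈ W ∧ ∀ y ∈ W ∩ planeSection a κ, ∀ z ∈ W ∩ planeSection a κ,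
      mink y (lcross a x) = mink z (lcross a x) → y = z := by
  obtain ⟨e1, e2⟩ := normal_of_curve hx.1 ha hx.2
  have ht : lcross (a - κ • x) x = lcross a x := by
    simp only [← lcrossL_apply, map_sub, map_smul, sub_apply, smul_apply]
    rw [lcrossL_apply x x, lcross_self, smul_zero, sub_zero]
  have hc : Continuous fun y : R31 => (κ ^ 2 - 1) * (-mink y x - 1) := by
    have : Continuous fun y : R31 => mink y x :=
      (minkL.flip x).continuous
    fun_prop
  have hxx := mink_self_of_mem hx.1
  -- In the frame `x`, `a ⊠ x`, `a - κ x` a point of the curve has coordinates `1 + r`, `t`, `κ r`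
  -- with `r = -⟨y,x⟩ - 1`, and `⟨y,y⟩ = -1` reads `(κ² - 1) r² - 2 r + t² = 0`. Distinct roots for
  -- the same `t` satisfy `(κ² - 1)(r + r') = 2`, which this open condition rules out.
  refine ⟨{y | (κ ^ 2 - 1) * (-mink y x - 1) < 1}, isOpen_lt hc continuous_const, ?_, ?_⟩
  · change (κ ^ 2 - 1) * (-mink x x - 1) < 1
    rw [hxx]; norm_num
  · rintro y ⟨hy, hyc⟩ z ⟨hz, hzc⟩ hyz
    change (κ ^ 2 - 1) * (-mink y x - 1) < 1 at hy
    change (κ ^ 2 - 1) * (-mink z x - 1) < 1 at hz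
    have quad : ∀ {y}, y ∈ planeSection a κ → mink y (a - κ • x) = κ * (-mink y x - 1) ∧
        (κ ^ 2 - 1) * (-mink y x - 1) ^ 2 - 2 * (-mink y x - 1) + mink y (lcross a x) ^ 2 = 0 := by
      intro y hy
      have h1 : mink y (a - κ • x) = κ * (-mink y x - 1) := by
        rw [mink_sub_right, mink_smul_right, hy.2]; ring
      refine ⟨h1, ?_⟩
      have h2 := congrArg (mink y) (frame_expansion hx.1 e1 e2 y)
      rw [mink_self_of_mem hy.1, ht, mink_add_right, mink_add_right, mink_smul_right,
        mink_smul_right, mink_smul_right, h1] at h2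
      linear_combination -h2
    obtain ⟨y1, y2⟩ := quad hyc
    obtain ⟨z1, z2⟩ := quad hzc
    have hxyz : mink y x = mink z x := by
      have h3 : (mink y x - mink z x) *
          ((κ ^ 2 - 1) * (-mink y x - 1) + (κ ^ 2 - 1) * (-mink z x - 1) - 2) = 0 := by
        rw [hyz] at y2
        linear_combination z2 - y2
      rcases mul_eq_zero.1 h3 with h4 | h4
      · linarith
      · linarith
    rw [frame_expansion hx.1 e1 e2 y, frame_expansion hx.1 e1 e2 z, y1, z1, ht, hxyz, hyz]

/-- The tangential coordinate has derivative one along the orbit at time zero, so it takes all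
nearby values there; local injectivity of that coordinate on the curve identifies the points. -/
theorem exists_nhds_orbit (ha : mink a a = 1 - κ ^ 2) (hx : x ∈ planeSection a κ) :
    ∀ᶠ y in 𝓝 x, y ∈ planeSection a κ → ∃ s, y = orbit a x s := by
  obtain ⟨W, hWo, hxW, hW⟩ := exists_nhds_injOn ha hx
  have hd : HasStrictDerivAt (fun s => mink (orbit a x s) (lcross a x)) 1 0 := by
    have h1 : ContDiffAt ℝ ∞ (fun s => mink (orbit a x s) (lcross a x)) 0 :=
      ((minkL.flip (lcross a x)).contDiff.contDiffAt).comp 0 (contDiff_orbit a x).contDiffAt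
    have h2 := h1.hasStrictDerivAt (by simp)
    have h3 := hasDerivAt_mink (hasDerivAt_orbit a x 0) (hasDerivAt_const 0 (lcross a x))
    rw [orbit_zero, mink_lcross_self_of_planeSection ha hx, mink_zero_right, add_zero] at h3
    rwa [h3.deriv] at h2
  have hnhds := hd.map_nhds_eq one_ne_zero
  have hs : {s | orbit a x s ∈ W} ∈ 𝓝 (0 : ℝ) :=
    (contDiff_orbit a x).continuous.continuousAt.preimage_mem_nhds
      (hWo.mem_nhds (by rwa [orbit_zero]))
  have him := image_mem_map (m := fun s => mink (orbit a x s) (lcross a x)) hs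
  rw [hnhds] at him
  simp only [orbit_zero] at him
  have hc : Continuous fun y : R31 => mink y (lcross a x) := (minkL.flip (lcross a x)).continuous
  filter_upwards [hWo.mem_nhds hxW, hc.continuousAt.preimage_mem_nhds him] with y hyW hy hyc
  obtain ⟨s, hsW, hsy⟩ := hy
  exact ⟨s, hW y ⟨hyW, hyc⟩ _ ⟨hsW, orbit_mem_planeSection hx s⟩ hsy.symm⟩

/-- A connected subset of the curve `⟨x, a⟩ = -κ` lies in a single orbit. -/
theorem exists_orbit {S : Type*} [TopologicalSpace S] [ConnectedSpace S] {f : S → R31}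
    (hf : Continuous f) (ha : mink a a = 1 - κ ^ 2) (hfc : ∀ p, f p ∈ planeSection a κ) :
    ∃ x ∈ planeSection a κ, ∀ p, ∃ s, f p = orbit a x s := by
  obtain ⟨x, hx⟩ := exists_forall_of_rigid
    (fun p x => x ∈ planeSection a κ ∧ ∃ s, f p = orbit a x s)
    (fun p => ⟨f p, (hf.continuousAt.eventually (exists_nhds_orbit ha (hfc p))).mono
      fun q hq => ⟨hfc p, hq (hfc q)⟩⟩)
    -- Two orbits with a common point coincide, by the group law.
    (fun p x y ⟨_, s, hs⟩ ⟨hy, t, ht⟩ q ⟨_, r, hr⟩ => by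
      refine ⟨hy, r - s + t, ?_⟩
      rw [orbit_add, ← ht, hs, ← orbit_add, hr]
      congr 1; ring)
  obtain ⟨p₀⟩ := (inferInstance : Nonempty S)
  exact ⟨x, (hx p₀).1, fun p => (hx p).2⟩

end Orbits

/-! ### Surfaces with parallel second fundamental form -/

/-- Converse of `IsCurveFrame.inCurve`: since `a` and `κ` are constant, `n = a - κ y` satisfies `dn
= -κ dy` at once. -/
theorem isCurveFrame_of_planeSection {y : R2 → R31} {U : Set R2} {a : R31} {κ : ℝ}
    (hU : IsOpen U) (hy : ∀ u ∈ U, DifferentiableAt ℝ y u) (ha : mink a a = 1 - κ ^ 2)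
    (h : ∀ u ∈ U, y u ∈ planeSection a κ) :
    IsCurveFrame y (fun u => a - κ • y u) (fun _ => κ) U where
  diff u hu := ((hy u hu).const_smul κ).const_sub a
  diff_curv u _ := differentiableAt_const κ
  norm u hu := (normal_of_curve (h u hu).1 ha (h u hu).2).1
  orth u hu := (normal_of_curve (h u hu).1 ha (h u hu).2).2
  tangent u hu v := by
    have near : ∀ᶠ z in 𝓝 u, z ∈ U := hU.mem_nhds hu
    have h1 : InCurve y u a κ := ⟨ha, near.mono fun z hz => (h z hz).2⟩
    rw [mink_sub_left, mink_smul_left, mink_comm a, h1.mink_fderiv (hy u hu), mink_comm (y u),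
      mink_fderiv_self_of_eventually_eq (hy u hu) (near.mono fun z hz => mink_self_of_mem (h z hz).1)]
    ring
  deriv u hu v := by
    rw [fderiv_const_sub, fderiv_fun_const_smul (hy u hu)]
    simp

namespace IsPatch

variable {x : R2 → R62} {U : Set R2} {u : R2} {A B : R31 →L[ℝ] R31}

/-- The linear relation `A w₁ = B w₂` passes from `x` to its derivatives, to their projections and
so to `h`. It also makes both factors contribute equally to inner products, so a normal vector
satisfying it is orthogonal to each factor of the tangent plane and vanishes. -/
theorem sff_eq_zero_of_graph (h : IsPatch x U) (hA : ∀ v w, mink (A v) (A w) = mink v w)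
    (hB : ∀ v w, mink (B v) (B w) = mink v w) (hx : ∀ u ∈ U, A (x u).1 = B (x u).2)
    (hu : u ∈ U) (Y : R2 → R2) {Z : R2 → R2} (hZ : DifferentiableAt ℝ Z u) : sff x Y Z u = 0 := by
  have key : ∀ f : R2 → R62, (∀ z ∈ U, A (f z).1 = B (f z).2) → ∀ z ∈ U, DifferentiableAt ℝ f z →
      ∀ v, A (fderiv ℝ f z v).1 = B (fderiv ℝ f z v).2 := by
    intro f hf z hz hd v
    have e1 : (fun y => A (f y).1) =ᶠ[𝓝 z] fun y => B (f y).2 := (h.eventually hz).mono hf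
    have d1 := A.hasFDerivAt.comp z hd.fst.hasFDerivAt
    have d2 := B.hasFDerivAt.comp z hd.snd.hasFDerivAt
    have e2 : A (fderiv ℝ (fun y => (f y).1) z v) = B (fderiv ℝ (fun y => (f y).2) z v) :=
      congrArg (fun T : R2 →L[ℝ] R31 => T v) (d1.unique (d2.congr_of_eventuallyEq e1))
    rwa [fderiv_fst_apply hd, fderiv_snd_apply hd] at e2
  have k1 : ∀ z ∈ U, ∀ v, A (fderiv ℝ x z v).1 = B (fderiv ℝ x z v).2 := fun z hz v =>
    key x hx z hz (h.diff hz) v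
  have hg : ∀ v w, mink (fderiv ℝ x u v).1 (fderiv ℝ x u w).1 =
      mink (fderiv ℝ x u v).2 (fderiv ℝ x u w).2 := fun v w => by
    rw [← hA, k1 u hu, k1 u hu, hB]
  set W := fderiv ℝ (fun y => fderiv ℝ x y (Z y)) u (Y u) with hW
  have k2 : A W.1 = B W.2 := key _ (fun z hz => k1 z hz (Z z)) u hu
    ((differentiableAt_of_infty (contDiffAt_fderiv (h.smooth u hu))).clm_apply hZ) _
  set N := sff x Y Z u with hN
  have hNm : N ∈ tangentHH (x u) := h.normalPart_mem hu _
  have hNt : ∀ v, ip N (fderiv ℝ x u v) = 0 := h.ip_normalPart_fderiv hu _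
  have k3 : A N.1 = B N.2 := by
    rw [hN, h.sff_eq hu, ← hW]
    have : mink W.1 (x u).1 = mink W.2 (x u).2 := by rw [← hA, ← hB W.2, k2, hx u hu]
    simp only [projHH, Prod.fst_sub, Prod.snd_sub, map_sub, map_add, map_smul, k2, this, hx u hu,
      k1 u hu]
  have hN1 : N.1 = 0 := by
    refine eq_of_mink_eq fun c => ?_
    -- The position vector and the tangent vectors of the first component span `ℝ³₁`, so it suffices
    -- to pair `N.1` with these.
    obtain ⟨α, v, rfl⟩ := h.exists_eq_smul_add hu hg c
    have h1 := hNt v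
    have h2 : mink N.2 (fderiv ℝ x u v).2 = mink N.1 (fderiv ℝ x u v).1 := by
      rw [← hB, ← k1 u hu, ← k3, hA]
    rw [ip, h2] at h1
    rw [mink_add_right, mink_smul_right, hNm.1, mink_zero_left]
    linarith
  refine Prod.ext hN1 (eq_zero_of_mink_self (h.mem u hu).2 hNm.2 ?_)
  rw [← hB, ← k3, hA, hN1, mink_zero_left]

theorem nablaSff_eq_zero_of_graph (h : IsPatch x U) (hA : ∀ v w, mink (A v) (A w) = mink v w)
    (hB : ∀ v w, mink (B v) (B w) = mink v w) (hx : ∀ u ∈ U, A (x u).1 = B (x u).2)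
    (hu : u ∈ U) {X Y Z : R2 → R2} (hX : ContDiffOn ℝ ∞ X U) (hZ : ContDiffOn ℝ ∞ Z U) :
    nablaSff x X Y Z u = 0 := by
  have hX' := fun y hy => hX.contDiffAt (h.isOpen.mem_nhds (x := y) hy)
  have hZ' := fun y hy => hZ.contDiffAt (h.isOpen.mem_nhds (x := y) hy)
  have h0 : sff x Y Z =ᶠ[𝓝 u] fun _ => 0 := (h.eventually hu).mono fun z hz =>
    h.sff_eq_zero_of_graph hA hB hx hz Y (differentiableAt_of_infty (hZ' z hz))
  rw [nablaSff, nablaNormal, h0.fderiv_eq,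
    h.sff_eq_zero_of_graph hA hB hx hu _ (differentiableAt_of_infty (hZ' u hu)),
    h.sff_eq_zero_of_graph hA hB hx hu _ (differentiableAt_of_infty
      (h.contDiffAt_nablaTangent hu (hX' u hu) (hZ' u hu)))]
  have hn : normalPart x u 0 = 0 := by
    have hp : projHH (x u) 0 = 0 := by simp [projHH]
    have ht : tangentialPart x u 0 = 0 := by
      simp only [tangentialPart, ip_zero_left]
      ext i; simp [Matrix.mulVec, dotProduct]
    rw [normalPart, hp, ht, map_zero, sub_zero]
  simp [hn]

end IsPatch

/-! ### Open parts -/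

theorem isOpenPart_of_forall {A T : Set R62} (hAT : A ⊆ T)
    (h : ∀ a ∈ A, ∃ V ∈ 𝓝 a, V ∩ T ⊆ A) : IsOpenPart A T := by
  refine ⟨{y | ∃ V, IsOpen V ∧ y ∈ V ∧ V ∩ T ⊆ A}, ?_, ?_⟩
  · rw [isOpen_iff_mem_nhds]
    rintro y ⟨V, hV, hy, hVA⟩
    exact mem_of_superset (hV.mem_nhds hy) fun z hz => ⟨V, hV, hz, hVA⟩
  · refine Subset.antisymm (fun a ha => ⟨?_, hAT ha⟩) fun a ⟨⟨V, _, haV, hVA⟩, haT⟩ =>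
      hVA ⟨haV, haT⟩
    obtain ⟨V, hV, hVA⟩ := h a ha
    obtain ⟨W, hWV, hW, haW⟩ := mem_nhds_iff.1 hV
    exact ⟨W, hW, haW, fun z hz => hVA ⟨hWV hz.1, hz.2⟩⟩

/-- Division by `√2` turns `⟨x,x⟩ = -2` into `⟨y,y⟩ = -1`, so the model is the full diagonal of `ℍ²
× ℍ²`. -/
theorem mem_diagonalSurface {y : R62} : y ∈ diagonalSurface ↔ y.1 = y.2 ∧ y.1 ∈ hyp (-1) := by
  have h2 : (0 : ℝ) < √2 := by positivity
  have hsq : √2 * √2 = 2 := Real.mul_self_sqrt (by norm_num)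
  constructor
  · rintro ⟨x, ⟨hx1, hx0⟩, rfl⟩
    refine ⟨rfl, mem_hyp_iff.2 ⟨?_, ?_⟩⟩
    · simp only [Prod.smul_fst, mink_smul_left, mink_smul_right, hx1]
      field_simp
      nlinarith
    · simp only [Prod.smul_fst, Pi.smul_apply, smul_eq_mul]
      positivity
  · rintro ⟨h12, hy⟩
    obtain ⟨hy1, hy0⟩ := mem_hyp_iff.1 hy
    refine ⟨√2 • y.1, ⟨?_, ?_⟩, ?_⟩
    · rw [mink_smul_left, mink_smul_right, hy1, ← mul_assoc, hsq]; norm_num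
    · exact mul_pos h2 hy0
    · refine Prod.ext ?_ ?_
      · rw [Prod.smul_fst, smul_smul, one_div_mul_cancel h2.ne', one_smul]
      · rw [Prod.smul_snd, smul_smul, one_div_mul_cancel h2.ne', one_smul, h12]

section Surface

variable {S : Type*} [TopologicalSpace S] [ChartedSpace R2 S] [IsManifold (𝓡 2) ∞ S] {Φ : S → R62}

/-- A linear map which is injective on a tangent plane restricts to an open map near the point. -/
theorem image_mem_nhds_of_injective (hΦ : IsLagrangianImmersion Φ) (p : S) (ℓ : R62 →L[ℝ] ℝ × ℝ)
    (hinj : ∀ v, ℓ (fderiv ℝ (fun y => Φ ((chartAt R2 p).symm y)) (chartAt R2 p p) v) = 0 →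
      fderiv ℝ (fun y => Φ ((chartAt R2 p).symm y)) (chartAt R2 p p) v = 0)
    {V : Set S} (hV : V ∈ 𝓝 p) : (fun q => ℓ (Φ q)) '' V ∈ 𝓝 (ℓ (Φ p)) := by
  obtain ⟨he, hps, hpt, hpe⟩ := chart_facts p
  set e := chartAt R2 p
  have hP := isPatch_chart hΦ he
  have hs : HasStrictFDerivAt (fun z => ℓ (Φ (e.symm z)))
      (ℓ.comp (fderiv ℝ (fun y => Φ (e.symm y)) (e p))) (e p) :=
    ℓ.hasStrictFDerivAt.comp (e p) ((hP.smooth _ hpt).hasStrictFDerivAt (by simp))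
  have hsurj : (ℓ.comp (fderiv ℝ (fun y => Φ (e.symm y)) (e p))).range = ⊤ := by
    rw [LinearMap.range_eq_top]
    refine (LinearMap.injective_iff_surjective_of_finrank_eq_finrank (by simp)).1 ?_
    rw [injective_iff_map_eq_zero]
    intro v hv
    exact hP.inj _ hpt ((hinj v hv).trans (map_zero _).symm)
  have hmap := hs.map_nhds_eq_of_surj hsurj
  have hVe : e.symm ⁻¹' V ∈ 𝓝 (e p) :=
    (e.continuousAt_symm hpt).preimage_mem_nhds (by rwa [hpe])
  have him := image_mem_map (m := fun z => ℓ (Φ (e.symm z))) hVe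
  rw [hmap, hpe] at him
  refine mem_of_superset him ?_
  rintro _ ⟨z, hz, rfl⟩
  exact ⟨e.symm z, hz, rfl⟩

theorem isOpenPart_productOfCurves (hΦ : IsLagrangianImmersion Φ) {a₁ a₂ x₁ x₂ : R31} {κ₁ κ₂ : ℝ}
    (ha₁ : mink a₁ a₁ = 1 - κ₁ ^ 2) (ha₂ : mink a₂ a₂ = 1 - κ₂ ^ 2)
    (hx₁ : x₁ ∈ planeSection a₁ κ₁) (hx₂ : x₂ ∈ planeSection a₂ κ₂)
    (h₁ : ∀ p, ∃ s, (Φ p).1 = orbit a₁ x₁ s) (h₂ : ∀ p, ∃ s, (Φ p).2 = orbit a₂ x₂ s) :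
    IsOpenPart (range Φ) (productOfCurves univ univ (orbit a₁ x₁) (orbit a₂ x₂)) := by
  have hm₁ : ∀ p, (Φ p).1 ∈ planeSection a₁ κ₁ := fun p => by
    obtain ⟨s, hs⟩ := h₁ p
    rw [hs]; exact orbit_mem_planeSection hx₁ s
  have hm₂ : ∀ p, (Φ p).2 ∈ planeSection a₂ κ₂ := fun p => by
    obtain ⟨s, hs⟩ := h₂ p
    rw [hs]; exact orbit_mem_planeSection hx₂ s
  refine isOpenPart_of_forall ?_ ?_
  · rintro _ ⟨p, rfl⟩
    obtain ⟨s, hs⟩ := h₁ p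
    obtain ⟨t, ht⟩ := h₂ p
    exact ⟨s, mem_univ _, t, mem_univ _, Prod.ext hs ht⟩
  · rintro _ ⟨p, rfl⟩
    obtain ⟨W₁, hW₁o, hpW₁, hW₁⟩ := exists_nhds_injOn ha₁ (hm₁ p)
    obtain ⟨W₂, hW₂o, hpW₂, hW₂⟩ := exists_nhds_injOn ha₂ (hm₂ p)
    -- The tangential coordinates at `Φ p`: injective on the tangent plane of the surface, and
    -- injective near `Φ p` on the product of plane sections. Hence every point of the product near
    -- `Φ p` is a value of `Φ`.
    let ℓ : R62 →L[ℝ] ℝ × ℝ := ContinuousLinearMap.prodMap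
      (minkL (lcross a₁ (Φ p).1)) (minkL (lcross a₂ (Φ p).2))
    have hℓ : ∀ y, ℓ y = (mink y.1 (lcross a₁ (Φ p).1), mink y.2 (lcross a₂ (Φ p).2)) := fun y =>
      Prod.ext (mink_comm _ _) (mink_comm _ _)
    have hWo : IsOpen (W₁ ×ˢ W₂) := hW₁o.prod hW₂o
    have hV : Φ ⁻¹' (W₁ ×ˢ W₂) ∈ 𝓝 p :=
      hΦ.smooth.continuous.continuousAt.preimage_mem_nhds (hWo.mem_nhds ⟨hpW₁, hpW₂⟩)
    have him := image_mem_nhds_of_injective hΦ p ℓ (fun v hv => by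
      obtain ⟨he, hps, hpt, hpe⟩ := chart_facts p
      have hP := isPatch_chart hΦ he
      set e := chartAt R2 p
      have ht := hP.fderiv_mem hpt v
      have f₁ := isCurveFrame_of_planeSection hP.isOpen (y := fun z => (Φ (e.symm z)).1)
        (fun u hu => (hP.diff hu).fst) ha₁ (fun u _ => hm₁ _)
      have f₂ := isCurveFrame_of_planeSection hP.isOpen (y := fun z => (Φ (e.symm z)).2)
        (fun u hu => (hP.diff hu).snd) ha₂ (fun u _ => hm₂ _)
      have g₁ := f₁.tangent _ hpt v
      have g₂ := f₂.tangent _ hpt v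
      rw [fderiv_fst_apply (hP.diff hpt)] at g₁
      rw [fderiv_snd_apply (hP.diff hpt)] at g₂
      have t₁ := IsPatch.eq_smul_of_normal (hm₁ (e.symm (e p))).1 (f₁.norm _ hpt) (f₁.orth _ hpt)
        ht.1 g₁
      have t₂ := IsPatch.eq_smul_of_normal (hm₂ (e.symm (e p))).1 (f₂.norm _ hpt) (f₂.orth _ hpt)
        ht.2 g₂
      have hl : ∀ (a y : R31) (κ : ℝ), lcross (a - κ • y) y = lcross a y := fun a y κ => by
        simp only [← lcrossL_apply, map_sub, map_smul, sub_apply, smul_apply]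
        rw [lcrossL_apply y y, lcross_self, smul_zero, sub_zero]
      rw [hℓ, Prod.mk_eq_zero] at hv
      rw [hl, hpe, hv.1, zero_smul] at t₁
      rw [hl, hpe, hv.2, zero_smul] at t₂
      exact Prod.ext t₁ t₂) hV
    refine ⟨(W₁ ×ˢ W₂) ∩ ℓ ⁻¹' ((fun q => ℓ (Φ q)) '' (Φ ⁻¹' (W₁ ×ˢ W₂))),
      inter_mem (hWo.mem_nhds ⟨hpW₁, hpW₂⟩) (ℓ.continuous.continuousAt.preimage_mem_nhds him), ?_⟩
    rintro y ⟨⟨hyW, q, hqW, hqy⟩, s, -, t, -, hst⟩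
    refine ⟨q, ?_⟩
    simp only [hℓ, Prod.mk.injEq] at hqy
    refine Prod.ext (hW₁ _ ⟨hqW.1, hm₁ q⟩ _ ⟨hyW.1, ?_⟩ hqy.1)
      (hW₂ _ ⟨hqW.2, hm₂ q⟩ _ ⟨hyW.2, ?_⟩ hqy.2)
    · rw [hst]; exact orbit_mem_planeSection hx₁ s
    · rw [hst]; exact orbit_mem_planeSection hx₂ t

theorem eq_of_mem_hyp {y z : R31} (hy : y ∈ hyp (-1)) (hz : z ∈ hyp (-1)) (h1 : y 1 = z 1)
    (h2 : y 2 = z 2) : y = z := by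
  obtain ⟨hy1, hy0⟩ := mem_hyp_iff.1 hy
  obtain ⟨hz1, hz0⟩ := mem_hyp_iff.1 hz
  simp only [mink, h1, h2] at hy1 hz1
  have h0 : y 0 = z 0 := (mul_self_inj hy0.le hz0.le).1 (by linarith)
  ext i
  fin_cases i
  · exact h0
  · exact h1
  · exact h2

/-- The last two coordinates of the second factor are a chart of `ℍ²`, and of the surface as well: a
direction killed by the second component is killed by the first, because the metrics agree. -/
theorem isOpenPart_diagonalSurface (hΦ : IsLagrangianImmersion Φ) (hg : ∀ p, SameMetric Φ p)
    {F : R62 → R62} (hF : ∀ p, F (Φ p) = ((Φ p).2, (Φ p).2)) :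
    IsOpenPart (F '' range Φ) diagonalSurface := by
  refine isOpenPart_of_forall ?_ ?_
  · rintro _ ⟨_, ⟨p, rfl⟩, rfl⟩
    rw [hF, mem_diagonalSurface]
    exact ⟨rfl, (hΦ.mem p).2⟩
  · rintro _ ⟨_, ⟨p, rfl⟩, rfl⟩
    let ℓ : R62 →L[ℝ] ℝ × ℝ := ((ContinuousLinearMap.proj (R := ℝ) (φ := fun _ : Fin 3 => ℝ) 1).prod
      (ContinuousLinearMap.proj (R := ℝ) (φ := fun _ : Fin 3 => ℝ) 2)).comp
        (ContinuousLinearMap.snd ℝ R31 R31)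
    have hℓ : ∀ y, ℓ y = (y.2 1, y.2 2) := fun y => rfl
    have him := image_mem_nhds_of_injective hΦ p ℓ (fun v hv => by
      obtain ⟨he, hps, hpt, hpe⟩ := chart_facts p
      have hP := isPatch_chart hΦ he
      set e := chartAt R2 p
      have ht := (hP.fderiv_mem hpt v).2
      have h0 := (mem_hyp_iff.1 (hP.mem _ hpt).2).2
      rw [hℓ, Prod.mk_eq_zero] at hv
      simp only [mink, hv.1, hv.2, zero_mul, add_zero, neg_eq_zero] at ht
      have h2 : (fderiv ℝ (fun y => Φ (e.symm y)) (e p) v).2 = 0 := by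
        ext i
        fin_cases i
        · exact (mul_eq_zero.1 ht).resolve_right h0.ne'
        · exact hv.1
        · exact hv.2
      have h3 := (sameMetric_chart hΦ.smooth he hpt).1 (hg _) v v
      rw [h2, mink_zero_left] at h3
      exact Prod.ext (eq_zero_of_mink_self (hP.mem _ hpt).1 (hP.fderiv_mem hpt v).1 h3) h2)
      univ_mem
    rw [hF]
    refine ⟨ℓ ⁻¹' ((fun q => ℓ (Φ q)) '' univ), ℓ.continuous.continuousAt.preimage_mem_nhds ?_, ?_⟩
    · exact him
    · rintro y ⟨⟨q, -, hq⟩, hy⟩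
      rw [mem_diagonalSurface] at hy
      simp only [hℓ, Prod.mk.injEq] at hq
      have h2 : (Φ q).2 = y.2 := eq_of_mem_hyp (hΦ.mem q).2 (hy.1 ▸ hy.2) hq.1 hq.2
      exact ⟨Φ q, ⟨q, rfl⟩, by rw [hF, h2]; exact Prod.ext hy.1.symm rfl⟩

theorem hasParallelSff_of_planeSection (hΦ : IsLagrangianImmersion Φ) {a₁ a₂ : R31} {κ₁ κ₂ : ℝ}
    (ha₁ : mink a₁ a₁ = 1 - κ₁ ^ 2) (ha₂ : mink a₂ a₂ = 1 - κ₂ ^ 2)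
    (h₁ : ∀ p, mink (Φ p).1 a₁ = -κ₁) (h₂ : ∀ p, mink (Φ p).2 a₂ = -κ₂) :
    HasParallelSff Φ := by
  intro e he X Y Z hX hY hZ u hu
  have hP := isPatch_chart hΦ he
  have f₁ := isCurveFrame_of_planeSection hP.isOpen (y := fun z => (Φ (e.symm z)).1)
    (fun u hu => (hP.diff hu).fst) ha₁ (fun u _ => ⟨(hΦ.mem _).1, h₁ _⟩)
  have f₂ := isCurveFrame_of_planeSection hP.isOpen (y := fun z => (Φ (e.symm z)).2)
    (fun u hu => (hP.diff hu).snd) ha₂ (fun u _ => ⟨(hΦ.mem _).2, h₂ _⟩)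
  rw [hP.nablaSff_of_frames hu f₁ f₂ hX hY hZ]
  simp

theorem hasParallelSff_of_graph (hΦ : IsLagrangianImmersion Φ) {A B : Matrix (Fin 3) (Fin 3) ℝ}
    (hA : A ∈ OPlus) (hB : B ∈ OPlus) (h : ∀ p, A.mulVec (Φ p).1 = B.mulVec (Φ p).2) :
    HasParallelSff Φ := by
  intro e he X Y Z hX hY hZ u hu
  exact (isPatch_chart hΦ he).nablaSff_eq_zero_of_graph
    (A := A.mulVecLin.toContinuousLinearMap) (B := B.mulVecLin.toContinuousLinearMap)
    hA.1 hB.1 (fun u _ => h _) hu hX hZ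

end Surface

/-! ### Lorentz transformations -/

theorem mink_lcross_eq_det (a b c : R31) :
    mink (lcross a b) c = (Matrix.of ![a, b, c]).det := by
  rw [mink_lcross, Matrix.det_fin_three]
  simp
  ring

theorem mink_lcross_mulVec (M : Matrix (Fin 3) (Fin 3) ℝ) (a b c : R31) :
    mink (lcross (M.mulVec a) (M.mulVec b)) (M.mulVec c) = M.det * mink (lcross a b) c := by
  have h : Matrix.of ![M.mulVec a, M.mulVec b, M.mulVec c] =
      Matrix.of ![a, b, c] * M.transpose := by
    ext i j
    fin_cases i <;> simp [Matrix.mul_apply, Matrix.mulVec, dotProduct, mul_comm]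
  rw [mink_lcross_eq_det, h, Matrix.det_mul, Matrix.det_transpose, ← mink_lcross_eq_det, mul_comm]

/-- A map of determinant one preserves the triple product `⟨a ⊠ b, c⟩`; as it also preserves the
nondegenerate metric, it commutes with the cross product. -/
theorem mulVec_lcross {M : Matrix (Fin 3) (Fin 3) ℝ}
    (hM : ∀ v w : R31, mink (M.mulVec v) (M.mulVec w) = mink v w) (hdet : M.det = 1) (a b : R31) :
    M.mulVec (lcross a b) = lcross (M.mulVec a) (M.mulVec b) := by
  refine eq_of_mink_eq fun c => ?_
  have hc : c = M.mulVec (M⁻¹.mulVec c) := by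
    rw [Matrix.mulVec_mulVec, Matrix.mul_nonsing_inv _ (by rw [hdet]; exact isUnit_one),
      Matrix.one_mulVec]
  rw [hc, hM, mink_lcross_mulVec, hdet, one_mul]

/-- A Lorentz transformation mapping some point of `ℍ²` into `ℍ²` is orthochronous. -/
theorem mem_OPlus_of_mem_hyp {M : Matrix (Fin 3) (Fin 3) ℝ}
    (hM : ∀ v w : R31, mink (M.mulVec v) (M.mulVec w) = mink v w) {x : R31} (hx : x ∈ hyp (-1))
    (hMx : M.mulVec x ∈ hyp (-1)) : M ∈ OPlus := by
  refine ⟨hM, ?_⟩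
  have h1 := hM x ![1, 0, 0]
  have h2 := hM ![1, 0, 0] ![1, 0, 0]
  have h3 : M.mulVec ![1, 0, 0] 0 = M 0 0 := by
    simp [Matrix.mulVec, dotProduct, Fin.sum_univ_three]
  rw [← h3]
  obtain ⟨-, hx0⟩ := mem_hyp_iff.1 hx
  obtain ⟨hz, hz0⟩ := mem_hyp_iff.1 hMx
  generalize M.mulVec ![1, 0, 0] = y at h1 h2
  generalize M.mulVec x = z at h1 hz hz0
  simp [mink] at h1 h2 hz
  -- Here `y = M e₀` and `z = M x` are timelike with `⟨z,y⟩ = -x 0 < 0`. If `y 0 ≤ 0`, then `z 1 * y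
  -- 1 + z 2 * y 2 < z 0 * y 0 ≤ 0`, which contradicts the Cauchy–Schwarz bound for the spatial
  -- parts of two unit timelike vectors.
  by_contra! hy
  have hP : z 0 * y 0 ≤ 0 := mul_nonpos_of_nonneg_of_nonpos hz0.le hy
  have hQ : z 1 * y 1 + z 2 * y 2 < z 0 * y 0 := by linarith
  nlinarith [sq_nonneg (z 1 * y 2 - z 2 * y 1), sq_nonneg (z 1), sq_nonneg (z 2), sq_nonneg (y 1),
    sq_nonneg (y 2), mul_nonneg (sub_nonneg.2 hQ.le) (neg_nonneg.2 hP)]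

theorem one_mem_OPlus : (1 : Matrix (Fin 3) (Fin 3) ℝ) ∈ OPlus :=
  ⟨fun v w => by rw [Matrix.one_mulVec, Matrix.one_mulVec], by simp⟩

theorem exists_isometry_of_sameMetric {S : Type*} [TopologicalSpace S] [ConnectedSpace S]
    [ChartedSpace R2 S] [IsManifold (𝓡 2) ∞ S] {Φ : S → R62} (hΦ : IsLagrangianImmersion Φ)
    (hg : ∀ p, SameMetric Φ p) : ∃ F : R62 → R62, IsIsometryHH F ∧ IsHolomorphicHH F ∧
      ∀ p, F (Φ p) = ((Φ p).2, (Φ p).2) := by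
  obtain ⟨A, hA⟩ := exists_intertwinesAt hΦ hg
  set M := LinearMap.toMatrix' A.toLinearMap with hMdef
  have hMA : ∀ v, M.mulVec v = A v := fun v => by
    rw [hMdef, LinearMap.toMatrix'_mulVec]; rfl
  obtain ⟨p⟩ := (inferInstance : Nonempty S)
  obtain ⟨he, hps, hpt, hpe⟩ := chart_facts p
  have hP := isPatch_chart hΦ he
  have hgp := (sameMetric_chart hΦ.smooth he hpt).1 (hg _)
  have hi := (intertwinesAt_chart hΦ.smooth he hpt A).1 (hA _)
  have hM : ∀ v w : R31, mink (M.mulVec v) (M.mulVec w) = mink v w := fun v w => by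
    rw [hMA, hMA, hi.mink_map hP hpt hgp]
  -- The Lagrangian condition equates the area forms `ω₁` and `ω₂ = det M · ω₁`, and `ω₁ ≠ 0`.
  have hdet : M.det = 1 := by
    have h1 := hP.area_ne_zero hpt hgp
    have h2 := omega_chart hΦ he hpt (EuclideanSpace.single 0 1) (EuclideanSpace.single 1 1)
    simp only [omega, ip, J, mink_neg_left, ← hi.2] at h2
    rw [← hi.1, ← hMA, ← hMA, ← hMA, mink_lcross_mulVec] at h2
    exact mul_right_cancel₀ h1 (by linarith)
  have hMO : M ∈ OPlus := mem_OPlus_of_mem_hyp hM (hΦ.mem p).1 (by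
    rw [hMA, (hA p).1]; exact (hΦ.mem p).2)
  refine ⟨fun x => (M.mulVec x.1, (1 : Matrix (Fin 3) (Fin 3) ℝ).mulVec x.2),
    ⟨M, hMO, 1, one_mem_OPlus, Or.inl rfl⟩, fun x _ v _ => ?_, fun q => ?_⟩
  · simp only [J, mulVec_lcross hM hdet, Matrix.one_mulVec]
  · simp only [hMA, (hA q).1, Matrix.one_mulVec]

end HypProd

end

/-! ### The classification -/

open HypProd in
theorem mainTheorem2 {S : Type*} [TopologicalSpace S] [T2Space S] [SecondCountableTopology S]
    [ConnectedSpace S] [ChartedSpace R2 S] [IsManifold (𝓡 2) ∞ S]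
    (Φ : S → R62) (hΦ : IsLagrangianImmersion Φ) :
    HasParallelSff Φ ↔
      ((∃ (I₁ I₂ : Set ℝ) (β₁ β₂ : ℝ → R31),
          IsUnitSpeedCurve I₁ β₁ ∧ HasConstantGeodesicCurvature I₁ β₁ ∧
          IsUnitSpeedCurve I₂ β₂ ∧ HasConstantGeodesicCurvature I₂ β₂ ∧
          IsOpenPart (Set.range Φ) (productOfCurves I₁ I₂ β₁ β₂)) ∨
        (∃ F : R62 → R62, IsIsometryHH F ∧ (IsHolomorphicHH F ∨ IsAntiholomorphicHH F) ∧
          IsOpenPart (F '' Set.range Φ) diagonalSurface)) := by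
  constructor
  · intro hpar
    rcases areaZero_or_sameMetric hΦ hpar with hω | hg
    · left
      obtain ⟨⟨a₁, κ₁, ha₁, h₁⟩, a₂, κ₂, ha₂, h₂⟩ := exists_curves hΦ hpar hω
      have hc := hΦ.smooth.continuous
      obtain ⟨x₁, hx₁, ho₁⟩ := exists_orbit hc.fst ha₁ fun p => ⟨(hΦ.mem p).1, h₁ p⟩
      obtain ⟨x₂, hx₂, ho₂⟩ := exists_orbit hc.snd ha₂ fun p => ⟨(hΦ.mem p).2, h₂ p⟩
      exact ⟨Set.univ, Set.univ, orbit a₁ x₁, orbit a₂ x₂, isUnitSpeedCurve_orbit ha₁ hx₁,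
        hasConstantGeodesicCurvature_orbit ha₁ hx₁, isUnitSpeedCurve_orbit ha₂ hx₂,
        hasConstantGeodesicCurvature_orbit ha₂ hx₂,
        isOpenPart_productOfCurves hΦ ha₁ ha₂ hx₁ hx₂ ho₁ ho₂⟩
    · right
      obtain ⟨F, hF, hFJ, hFΦ⟩ := exists_isometry_of_sameMetric hΦ hg
      exact ⟨F, hF, Or.inl hFJ, isOpenPart_diagonalSurface hΦ hg hFΦ⟩
  · rintro (⟨I₁, I₂, β₁, β₂, hβ₁, ⟨κ₁, hκ₁⟩, hβ₂, ⟨κ₂, hκ₂⟩, O, -, hO⟩ | ⟨F, hF, -, O, -, hO⟩)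
    · have hmem : ∀ p, ∃ s₁ ∈ I₁, ∃ s₂ ∈ I₂, Φ p = (β₁ s₁, β₂ s₂) := fun p =>
        (hO.le (Set.mem_range_self p)).2
      obtain ⟨p₀⟩ := (inferInstance : Nonempty S)
      obtain ⟨r₁, hr₁, r₂, hr₂, -⟩ := hmem p₀
      obtain ⟨a₁, ha₁, h₁⟩ := hβ₁.exists_mink_eq hκ₁ hr₁
      obtain ⟨a₂, ha₂, h₂⟩ := hβ₂.exists_mink_eq hκ₂ hr₂
      refine hasParallelSff_of_planeSection hΦ ha₁ ha₂ (fun p => ?_) fun p => ?_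
      · obtain ⟨s₁, hs₁, s₂, hs₂, hp⟩ := hmem p
        rw [hp]; exact h₁ s₁ hs₁
      · obtain ⟨s₁, hs₁, s₂, hs₂, hp⟩ := hmem p
        rw [hp]; exact h₂ s₂ hs₂
    · have hmem : ∀ p, (F (Φ p)).1 = (F (Φ p)).2 := fun p =>
        (mem_diagonalSurface.1 (hO.le ⟨_, Set.mem_range_self p, rfl⟩).2).1
      -- Landing in the diagonal is a relation between the two components of `Φ` with Lorentz
      -- blocks; in the antidiagonal case the blocks exchange roles.
      obtain ⟨A, hA, B, hB, rfl | rfl⟩ := hF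
      · exact hasParallelSff_of_graph hΦ hA hB hmem
      · exact hasParallelSff_of_graph hΦ hB hA fun p => (hmem p).symm
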